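/- Let $d=3$ and let $p$ be the transition kernel of the simple nearest-neighbour random walk on $\mathbb Z^3$, so $p(x)=\frac16$ if $|x|_1=1$ and $p(x)=0$ otherwise; write $i\sim j$ if $p(i-j)>0$. Let $V(t)=t^2/2$, and let $\eta=(\eta_i)_{i\in\mathbb Z^3}$ be i.i.d. real random variables with finite second moment; write $\mathbb E$ for the expectation over $\eta$. For a finite set $\Lambda\subset\mathbb Z^3$ and a boundary condition $\hat\varphi$, the finite-volume Gibbs measure $\mu_\Lambda^{\hat\varphi}[\eta]$ is the probability measure on configurations $\varphi\in\mathbb R^{\mathbb Z^3}$ with $\varphi=\hat\varphi$ off $\Lambda$ whose density with respect to $\prod_{i\in\Lambda}d\varphi_i$ is proportional to $$\exp\Big\{-\tfrac12\sum_{i,j\in\Lambda}p(i-j)V(\varphi_i-\varphi_j)-\sum_{i\in\Lambda,\,j\notin\Lambda}p(i-j)V(\varphi_i-\hat\varphi_j)+\sum_{i\in\Lambda}\eta_i\varphi_i\Big\}.$$ The gradient field of $\varphi$ is $\varphi'_{ij}=\varphi_i-\varphi_j$ ($i\sim j$). The image of $\mu_\Lambda^{\hat\varphi}[\eta]$ under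 $\varphi\mapsto\varphi'$ depends on $\hat\varphi$ only through $\hat\varphi'$; a probability measure on gradient fields is a gradient Gibbs measure for $\eta$ if it is invariant under these kernels for every finite $\Lambda$ (DLR equations). Let $\eta\mapsto\mu'[\eta]$ be a translation-covariant random gradient Gibbs measure, that is, a measurable map into the probability measures on gradient fields such that, for almost every $\eta$, $\mu'[\eta]$ is a gradient Gibbs measure for $\eta$, and such that for every $r\in\mathbb Z^3$ and almost every $\eta$, $\mu'[\tau_r\eta]$ is the image of $\mu'[\eta]$ under $\tau_r$, where $(\tau_r\eta)_i=\eta_{i-r}$ and $(\tau_r\varphi')_{ij}=\varphi'_{i-r,j-r}$. Assume that for all $i\sim j$, $V'(\varphi'_{ij})$ is $\mu'[\eta]$-integrable for almost every $\eta$ and that $$X_{ij}[\eta]:=\int\mu'[\eta](d\varphi')\,V'(\varphi'_{ij})$$ satisfies $\mathbb E|X_{ij}|<\infty$. Then $\mathbb E(X_{ij}^2)<\infty$ for all $i\sim j$, and $$\limsup_{r\uparrow\infty}\ \sup_{i\sim j,\;k\sim l,\;|i-k|\ge r}\frac{|\operatorname{Cov}(X_{ij},X_{kl})|}{r^{-1}}<\infty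 ,$$ where $\operatorname{Cov}$ is the covariance under the law of $\eta$. In particular, if $\mu'$ has no tilt, that is, $\mathbb E(X_{ij})=0$ for all $i\sim j$, then $C(ij,kl):=\mathbb E(X_{ij}X_{kl})$ satisfies $$\limsup_{r\uparrow\infty}\ \sup_{i\sim j,\;k\sim l,\;|i-k|\ge r}\frac{|C(ij,kl)|}{r^{-1}}<\infty .$$ -/

import Mathlib

open MeasureTheory ProbabilityTheory Filter
open scoped ENNReal

namespace RandomInterface

noncomputable section

/-- Sites of the lattice `ℤ^d`. -/
abbrev Site (d : ℕ) := Fin d → ℤ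

/-- Euclidean distance of two sites. -/
def siteDist {d : ℕ} (i j : Site d) : ℝ := Real.sqrt (∑ k, ((i k : ℝ) - (j k : ℝ)) ^ 2)

/-- Transition kernel of the simple (nearest-neighbour) random walk on `ℤ^d`. -/
def nnKernel (d : ℕ) (x : Site d) : ℝ := if ∑ k, |x k| = 1 then 1 / (2 * (d : ℝ)) else 0

/-- The Gaussian pair potential. -/
def gaussianPotential (t : ℝ) : ℝ := t ^ 2 / 2

/-- Oriented edges `ij` of the graph of the random walk with transition kernel `p`. -/
abbrev Edge {d : ℕ} (p : Site d → ℝ) := {e : Site d × Site d // 0 < p (e.1 - e.2)}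

/-- The gradient field `φ'_{ij} = φ_i - φ_j` of a height configuration. -/
def grad {d : ℕ} (p : Site d → ℝ) (φ : Site d → ℝ) : Edge p → ℝ := fun e => φ e.1.1 - φ e.1.2

/-- The set of gradient field configurations, with the σ-algebra generated by the coordinates. -/
abbrev GradConf {d : ℕ} (p : Site d → ℝ) := {u : Edge p → ℝ // ∃ φ : Site d → ℝ, grad p φ = u}

/-- The gradient field of `φ`, as an element of the set of gradient configurations. -/
def toGradConf {d : ℕ} (p : Site d → ℝ) (φ : Site d → ℝ) : GradConf p := ⟨grad p φ, φ, rfl⟩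

theorem exists_potential {d : ℕ} {p : Site d → ℝ} (u : GradConf p) :
    ∃ φ : Site d → ℝ, φ 0 = 0 ∧ grad p φ = u.1 := by
  obtain ⟨φ, hφ⟩ := u.2
  refine ⟨fun i => φ i - φ 0, sub_self _, ?_⟩
  rw [← hφ]
  funext e
  simp [grad]

/-- A height configuration with gradient field `u`, normalized to vanish at the origin. -/
def potential {d : ℕ} {p : Site d → ℝ} (u : GradConf p) : Site d → ℝ :=
  Classical.choose (exists_potential u)

/-- The configuration equal to `x` in `Λ` and to the boundary condition `b` outside `Λ`. -/
def glue {d : ℕ} (Λ : Finset (Site d)) (b : Site d → ℝ) (x : Λ → ℝ) : Site d → ℝ :=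
  fun i => if h : i ∈ Λ then x ⟨i, h⟩ else b i

/-- The Hamiltonian in the finite volume `Λ`, including the interaction with the outside. -/
def energy {d : ℕ} (p : Site d → ℝ) (V : ℝ → ℝ) (Λ : Finset (Site d)) (η φ : Site d → ℝ) : ℝ :=
  1 / 2 * ∑ i ∈ Λ, ∑ j ∈ Λ, p (i - j) * V (φ i - φ j)
    + ∑ i ∈ Λ, ∑' j : {j : Site d // j ∉ Λ}, p (i - j) * V (φ i - φ j)
    - ∑ i ∈ Λ, η i * φ i

/-- The Boltzmann weight of the heights in `Λ`, for the boundary condition `b`. -/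
def weight {d : ℕ} (p : Site d → ℝ) (V : ℝ → ℝ) (Λ : Finset (Site d)) (η b : Site d → ℝ)
    (x : Λ → ℝ) : ℝ≥0∞ :=
  ENNReal.ofReal (Real.exp (-energy p V Λ η (glue Λ b x)))

/-- The quenched finite-volume Gibbs measure with boundary condition `b`. -/
def finiteGibbs {d : ℕ} (p : Site d → ℝ) (V : ℝ → ℝ) (Λ : Finset (Site d)) (η b : Site d → ℝ) :
    Measure (Site d → ℝ) :=
  (∫⁻ x, weight p V Λ η b x)⁻¹ •
    ((volume : Measure (Λ → ℝ)).withDensity (weight p V Λ η b)).map (glue Λ b)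

/-- The gradient finite-volume Gibbs measure with gradient boundary condition `u`. -/
def finiteGradGibbs {d : ℕ} (p : Site d → ℝ) (V : ℝ → ℝ) (Λ : Finset (Site d)) (η : Site d → ℝ)
    (u : GradConf p) : Measure (GradConf p) :=
  (finiteGibbs p V Λ η (potential u)).map (toGradConf p)

/-- The DLR equations, in every finite volume, for a measure on gradient configurations. -/
def IsGradientGibbs {d : ℕ} (p : Site d → ℝ) (V : ℝ → ℝ) (η : Site d → ℝ)
    (μ : Measure (GradConf p)) : Prop :=
  ∀ (Λ : Finset (Site d)) (A : Set (GradConf p)), MeasurableSet A →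
    ∫⁻ u, finiteGradGibbs p V Λ η u A ∂μ = μ A

/-- The lattice shift `(τ_r η)_i = η_{i - r}`. -/
def shift {d : ℕ} (r : Site d) (η : Site d → ℝ) : Site d → ℝ := fun i => η (i - r)

/-- The shift of gradient configurations, `(τ_r u)_{ij} = u_{i - r, j - r}`. -/
def shiftGrad {d : ℕ} {p : Site d → ℝ} (r : Site d) (u : GradConf p) : GradConf p :=
  ⟨fun e => u.1 ⟨(e.1.1 - r, e.1.2 - r), by simpa using e.2⟩, by
    obtain ⟨φ, hφ⟩ := u.2
    refine ⟨shift r φ, ?_⟩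
    rw [← hφ]
    rfl⟩

/-- The law of an i.i.d. disorder configuration with single-site distribution `ν`. -/
def disorderLaw (d : ℕ) (ν : Measure ℝ) [IsProbabilityMeasure ν] : Measure (Site d → ℝ) :=
  Measure.infinitePi (fun _ : Site d => ν)

/-- `η ↦ μ[η]` is a translation-covariant random gradient Gibbs measure under the law `P` of the
disorder: its values are probability measures depending measurably on `η` (a Markov kernel), almost
surely they satisfy the DLR equations, and they are covariant under lattice shifts. -/
structure IsRandomGradientGibbs {d : ℕ} (p : Site d → ℝ) (V : ℝ → ℝ) (P : Measure (Site d → ℝ))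
    (μ : Kernel (Site d → ℝ) (GradConf p)) : Prop where
  markov : IsMarkovKernel μ
  gibbs : ∀ᵐ η ∂P, IsGradientGibbs p V η (μ η)
  covariant : ∀ r : Site d, ∀ᵐ η ∂P, μ (shift r η) = (μ η).map (shiftGrad r)

/-- The associated vector field `X_{ij}[η] = ∫ V'(φ'_{ij}) dμ[η]`. -/
def vectorField {d : ℕ} {p : Site d → ℝ} (V : ℝ → ℝ) (μ : Kernel (Site d → ℝ) (GradConf p))
    (e : Edge p) (η : Site d → ℝ) : ℝ :=
  ∫ u, deriv V (u.1 e) ∂(μ η)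

/-- The supremum of `|D(ij, kl)| / r⁻¹` over all edges `ij`, `kl` with `|i - k| ≥ r`,
as an extended nonnegative number. -/
def decaySup {d : ℕ} {p : Site d → ℝ} (D : Edge p → Edge p → ℝ) (r : ℝ) : ℝ≥0∞ :=
  ⨆ (e : Edge p) (f : Edge p) (_ : r ≤ siteDist e.1.1 f.1.1), ENNReal.ofReal (|D e f| / r⁻¹)

end

end RandomInterface

open RandomInterface

/-! For the quadratic potential the DLR equation at a single site says that the divergence of the
gradient field there is Gaussian with mean `η i`, so the mean gradient field solves a discrete
Poisson equation with source `η`. Iterating that equation `n` times along a lazy random walk writes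
`X` as an explicit linear function of `η`, the gradient of the Green function truncated at time
`n`, plus the average of `X` over the position of the walk at time `n`. By covariance this last term
is an average of one integrable function over shifts of i.i.d. disorder, so it tends to the mean of
`X` in `L¹`. The Green function part is Cauchy in `L²`, because the second discrete derivatives
of the `n`-step transition probabilities are of order `n ^ (-d / 2 - 1)`; hence `X` is square
integrable, and the decay of its covariance is that of the double gradient of `∑ n, n * q ^ n`. -/

namespace RandomInterface

noncomputable section

section GroupAlgebra

open AddMonoidAlgebra

variable {G H : Type*}

/-- The pairing `∑ x, f x * h x` of an element of the group algebra with an arbitrary function. -/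
def pairing (h : G → ℝ) : ℝ[G] →ₗ[ℝ] ℝ :=
  Finsupp.linearCombination ℝ h ∘ₗ (coeffLinearEquiv ℝ).toLinearMap

@[simp] theorem pairing_single (h : G → ℝ) (x : G) (c : ℝ) : pairing h (single x c) = c * h x := by
  simp [pairing]

theorem pairing_eq_sum (h : G → ℝ) (f : ℝ[G]) :
    pairing h f = ∑ x ∈ f.coeff.support, f.coeff x * h x := by
  simp [pairing, Finsupp.linearCombination_apply, Finsupp.sum]

theorem sum_coeff_smul_single (f : ℝ[G]) :
    ∑ x ∈ f.coeff.support, f.coeff x • single x (1 : ℝ) = f := by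
  conv_rhs => rw [← sum_coeff_single f]
  simp [Finsupp.sum]

theorem coeff_single_nonneg (x : G) {c : ℝ} (hc : 0 ≤ c) : 0 ≤ (single x c).coeff :=
  Finsupp.single_nonneg.2 hc

/-- The `ℓ¹` norm of an element of the group algebra. -/
def l1 (f : ℝ[G]) : ℝ := ∑ x ∈ f.coeff.support, |f.coeff x|

theorem l1_eq_sum {f : ℝ[G]} {s : Finset G} (hs : f.coeff.support ⊆ s) :
    l1 f = ∑ x ∈ s, |f.coeff x| :=
  Finset.sum_subset hs fun x _ hx => by simpa using hx

theorem l1_nonneg (f : ℝ[G]) : 0 ≤ l1 f := Finset.sum_nonneg fun _ _ => abs_nonneg _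

theorem l1_add_le (f g : ℝ[G]) : l1 (f + g) ≤ l1 f + l1 g := by
  classical
  have h : (f + g).coeff.support ⊆ f.coeff.support ∪ g.coeff.support := by
    rw [coeff_add]; exact Finsupp.support_add
  rw [l1_eq_sum h, l1_eq_sum (Finset.subset_union_left (s₂ := g.coeff.support)),
    l1_eq_sum (Finset.subset_union_right (s₁ := f.coeff.support)), ← Finset.sum_add_distrib]
  exact Finset.sum_le_sum fun x _ => by simpa using abs_add_le (f.coeff x) (g.coeff x)

theorem l1_smul (c : ℝ) (f : ℝ[G]) : l1 (c • f) = |c| * l1 f := by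
  have h : (c • f).coeff.support ⊆ f.coeff.support := by
    rw [coeff_smul]; exact Finsupp.support_smul
  rw [l1_eq_sum h, l1, Finset.mul_sum]
  exact Finset.sum_congr rfl fun x _ => by simp [abs_mul]

@[simp] theorem l1_zero : l1 (0 : ℝ[G]) = 0 := by simp [l1]

@[simp] theorem l1_single (x : G) (c : ℝ) : l1 (single x c) = |c| := by
  classical
  rw [l1_eq_sum (s := {x}) (by simpa using Finsupp.support_single_subset)]
  simp

theorem l1_sum_le {ι : Type*} (s : Finset ι) (f : ι → ℝ[G]) :
    l1 (∑ i ∈ s, f i) ≤ ∑ i ∈ s, l1 (f i) :=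
  Finset.le_sum_of_subadditive l1 l1_zero.le l1_add_le s f

theorem abs_pairing_le {h : G → ℝ} (hh : ∀ x, |h x| ≤ 1) (f : ℝ[G]) :
    |pairing h f| ≤ l1 f := by
  rw [pairing_eq_sum]
  refine (Finset.abs_sum_le_sum_abs _ _).trans (Finset.sum_le_sum fun x _ => ?_)
  rw [abs_mul]
  exact mul_le_of_le_one_right (abs_nonneg _) (hh x)

theorem l1_map_le (T : ℝ[G] →ₗ[ℝ] ℝ[H]) {M : ℝ}
    (hT : ∀ x, l1 (T (single x 1)) ≤ M) (f : ℝ[G]) : l1 (T f) ≤ M * l1 f := by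
  conv_lhs => rw [← sum_coeff_smul_single f, map_sum]
  refine (l1_sum_le _ _).trans ?_
  rw [l1, Finset.mul_sum]
  refine Finset.sum_le_sum fun x _ => ?_
  rw [map_smul, l1_smul, mul_comm]
  exact mul_le_mul_of_nonneg_right (hT x) (abs_nonneg _)

variable [AddCommGroup G] [AddCommGroup H]

theorem l1_mul_le (f g : ℝ[G]) : l1 (f * g) ≤ l1 f * l1 g := by
  have translation_le (x : G) : l1 (single x 1 * g) ≤ l1 g := by
    simpa using l1_map_le (LinearMap.mulLeft ℝ (single x (1 : ℝ))) (M := 1)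
      (fun y => by simp [single_mul_single]) g
  simpa [mul_comm] using l1_map_le (LinearMap.mulRight ℝ g) translation_le f

theorem l1_mapDomain_le (φ : G →+ H) (f : ℝ[G]) :
    l1 (mapDomainAlgHom ℝ ℝ φ f) ≤ l1 f := by
  simpa using l1_map_le (mapDomainAlgHom ℝ ℝ φ).toLinearMap (M := 1) (fun y => by simp) f

theorem coeff_mul_nonneg {f g : ℝ[G]} (hf : 0 ≤ f.coeff) (hg : 0 ≤ g.coeff) :
    0 ≤ (f * g).coeff := by
  classical
  intro x
  rw [coeff_mul]
  refine Finset.sum_nonneg fun y _ => Finset.sum_nonneg fun z _ => ?_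
  dsimp only
  split_ifs
  · exact mul_nonneg (hf y) (hg z)
  · exact le_rfl

theorem coeff_pow_nonneg {f : ℝ[G]} (hf : 0 ≤ f.coeff) (n : ℕ) :
    0 ≤ (f ^ n).coeff := by
  induction n with
  | zero => exact coeff_single_nonneg 0 zero_le_one
  | succ n ih => rw [pow_succ]; exact coeff_mul_nonneg ih hf

/-- The augmentation `f ↦ ∑ x, f x` of the group algebra. -/
def mass : ℝ[G] →ₐ[ℝ] ℝ := lift ℝ ℝ G 1

@[simp] theorem mass_single (x : G) (c : ℝ) : mass (single x c) = c := by simp [mass]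

theorem mass_eq_sum (f : ℝ[G]) : mass f = ∑ x ∈ f.coeff.support, f.coeff x := by
  conv_lhs => rw [← sum_coeff_smul_single f]
  simp

theorem l1_eq_mass {f : ℝ[G]} (hf : 0 ≤ f.coeff) : l1 f = mass f := by
  rw [mass_eq_sum]
  exact Finset.sum_congr rfl fun x _ => abs_of_nonneg (hf x)

theorem mass_mapDomain (φ : G →+ H) (f : ℝ[G]) :
    mass (mapDomainAlgHom ℝ ℝ φ f) = mass f := by
  conv_lhs => rw [← sum_coeff_smul_single f]
  simp [mass_eq_sum f]

/-- Multiplication by an additive character, as a derivation of the group algebra. -/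
def charDerivation (χ : G →+ ℝ) : Derivation ℝ ℝ[G] ℝ[G] :=
  Derivation.mk' (Finsupp.linearCombination ℝ (fun x => single x (χ x)) ∘ₗ
      (coeffLinearEquiv ℝ).toLinearMap) (by
    intro f g
    induction f using AddMonoidAlgebra.induction_linear with
    | zero => simp
    | add x y hx hy => simp only [add_mul, map_add, hx, hy, smul_add, add_smul]; abel
    | single m r =>
      induction g using AddMonoidAlgebra.induction_linear with
      | zero => simp
      | add x y hx hy => simp only [mul_add, map_add, hx, hy, smul_add, add_smul]; abel
      | single m' r' =>
        simp only [single_mul_single, LinearMap.comp_apply, LinearEquiv.coe_coe,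
          coeffLinearEquiv_apply, coeff_single, Finsupp.linearCombination_single, map_add,
          smul_single, smul_eq_mul, add_comm m' m, ← single_add]
        congr 1; ring)

@[simp] theorem charDerivation_single (χ : G →+ ℝ) (x : G) (c : ℝ) :
    charDerivation χ (single x c) = single x (c * χ x) := by
  simp [charDerivation]

theorem coeff_charDerivation (χ : G →+ ℝ) (f : ℝ[G]) (x : G) :
    (charDerivation χ f).coeff x = χ x * f.coeff x := by
  classical
  induction f using AddMonoidAlgebra.induction_linear with
  | zero => simp
  | add f g hf hg => simp [hf, hg, mul_add]
  | single m c =>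
    simp only [charDerivation_single, coeff_single, Finsupp.single_apply]
    split_ifs with h <;> simp [h, mul_comm]

theorem coeff_iterate_charDerivation (χ : G →+ ℝ) (n : ℕ) (f : ℝ[G]) (x : G) :
    ((charDerivation χ)^[n] f).coeff x = χ x ^ n * f.coeff x := by
  induction n with
  | zero => simp
  | succ n ih => rw [Function.iterate_succ_apply', coeff_charDerivation, ih]; ring

theorem charDerivation_mapDomain_eq_zero {χ : H →+ ℝ} {φ : G →+ H} (h : χ.comp φ = 0)
    (f : ℝ[G]) : charDerivation χ (mapDomainAlgHom ℝ ℝ φ f) = 0 := by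
  have h' (x : G) : χ (φ x) = 0 := DFunLike.congr_fun h x
  rw [← sum_coeff_smul_single f]
  simp [h']

theorem mass_charDerivation_charDerivation_pow (χ : G →+ ℝ) {q : ℝ[G]}
    (h1 : mass q = 1) (h0 : mass (charDerivation χ q) = 0) (n : ℕ) :
    mass (charDerivation χ (charDerivation χ (q ^ n))) =
      n * mass (charDerivation χ (charDerivation χ q)) := by
  induction n with
  | zero => simp
  | succ n ih =>
    simp only [pow_succ, Derivation.leibniz, map_add, smul_eq_mul, map_mul, map_pow, h1, h0, ih]
    push_cast; ring

theorem l1_charDerivation_sq_le (χ : G →+ ℝ) {f : ℝ[G]} (hf : 0 ≤ f.coeff) :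
    l1 (charDerivation χ f) ^ 2 ≤ mass (charDerivation χ (charDerivation χ f)) * mass f := by
  have h (g : ℝ[G]) : (charDerivation χ g).coeff.support ⊆ g.coeff.support :=
    fun x hx => by
      simp only [Finsupp.mem_support_iff, coeff_charDerivation] at hx ⊢
      exact right_ne_zero_of_mul hx
  rw [l1_eq_sum (h f), mass_eq_sum, mass_eq_sum,
    Finset.sum_subset ((h _).trans (h f)) fun x _ hx => by simpa using hx]
  simp only [coeff_charDerivation, ← mul_assoc]
  refine Finset.sum_sq_le_sum_mul_sum_of_sq_le_mul _
    (fun x _ => mul_nonneg (mul_self_nonneg _) (hf x)) (fun x _ => hf x) (fun x _ => le_of_eq ?_)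
  rw [sq_abs]; ring

end GroupAlgebra

section Coupling

open AddMonoidAlgebra

variable {G : Type*} [AddCommGroup G]

/-- The measure `single 0 b + single a b + r` on `G`, lifted to `G × ℤ` so that the second
coordinate records by `-1` and `1` which of the two distinguished atoms is used. A step using
them is moved from one to the other at the cost of a translation by `a` only. -/
def atomLift (a : G) (b : ℝ) (r : ℝ[G]) : ℝ[G × ℤ] :=
  single (0, -1) b + single (a, 1) b + mapDomainAlgHom ℝ ℝ (AddMonoidHom.inl G ℤ) r

/-- The second coordinate of `G × ℤ`, as a real-valued additive character. -/
def sndChar (G : Type*) [AddCommGroup G] : G × ℤ →+ ℝ :=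
  (Int.castAddHom ℝ).comp (AddMonoidHom.snd G ℤ)

@[simp] theorem sndChar_apply (x : G × ℤ) : sndChar G x = x.2 := rfl

theorem coeff_atomLift_nonneg (a : G) {b : ℝ} (hb : 0 ≤ b) {r : ℝ[G]} (hr : 0 ≤ r.coeff) :
    0 ≤ (atomLift a b r).coeff :=
  add_nonneg (add_nonneg (coeff_single_nonneg _ hb) (coeff_single_nonneg _ hb))
    (Finsupp.mapDomain_nonneg hr)

theorem mass_atomLift (a : G) (b : ℝ) (r : ℝ[G]) : mass (atomLift a b r) = b + b + mass r := by
  simp only [atomLift, map_add, mass_single, mass_mapDomain]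

theorem mapDomain_fst_atomLift (a : G) (b : ℝ) (r : ℝ[G]) :
    mapDomainAlgHom ℝ ℝ (AddMonoidHom.fst G ℤ) (atomLift a b r) =
      single 0 b + single a b + r := by
  have hr : mapDomainAlgHom ℝ ℝ (AddMonoidHom.fst G ℤ)
      (mapDomainAlgHom ℝ ℝ (AddMonoidHom.inl G ℤ) r) = r := by
    conv_rhs => rw [← sum_coeff_smul_single r]
    conv_lhs => rw [← sum_coeff_smul_single r]
    simp
  simp [atomLift, hr, -mapDomainAlgHom_apply]
  simp

theorem charDerivation_atomLift (a : G) (b : ℝ) (r : ℝ[G]) :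
    charDerivation (sndChar G) (atomLift a b r) = single (a, 1) b - single (0, -1) b := by
  have h : (sndChar G).comp (AddMonoidHom.inl G ℤ) = 0 := by ext; simp
  simp only [atomLift, map_add, charDerivation_mapDomain_eq_zero h, charDerivation_single,
    sndChar_apply]
  simp [sub_eq_add_neg, add_comm]

theorem l1_charDerivation_atomLift_pow_le (a : G) {b : ℝ} (hb : 0 ≤ b) {r : ℝ[G]}
    (hr : 0 ≤ r.coeff) (h1 : mass (atomLift a b r) = 1) (n : ℕ) :
    l1 (charDerivation (sndChar G) (atomLift a b r ^ n)) ≤ √(n * (2 * b)) := by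
  have mean_zero : mass (charDerivation (sndChar G) (atomLift a b r)) = 0 := by
    simp [charDerivation_atomLift]
  have second_moment : mass (charDerivation (sndChar G) (charDerivation (sndChar G)
      (atomLift a b r))) = 2 * b := by
    simp [charDerivation_atomLift]; ring
  refine Real.le_sqrt_of_sq_le ((l1_charDerivation_sq_le _
    (coeff_pow_nonneg (coeff_atomLift_nonneg a hb hr) n)).trans_eq ?_)
  rw [mass_charDerivation_charDerivation_pow _ h1 mean_zero, second_moment, map_pow, h1, one_pow,
    mul_one]

theorem mapDomain_fst_charDerivation_atomLift_pow (a : G) (b : ℝ) (r : ℝ[G]) (n : ℕ) :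
    mapDomainAlgHom ℝ ℝ (AddMonoidHom.fst G ℤ)
        (charDerivation (sndChar G) (atomLift a b r ^ (n + 1))) =
      (-((n + 1) * b)) • ((1 - single a 1) * (single 0 b + single a b + r) ^ n) := by
  have h : mapDomainAlgHom ℝ ℝ (AddMonoidHom.fst G ℤ)
      (charDerivation (sndChar G) (atomLift a b r)) = (-b) • (1 - single a 1) := by
    rw [charDerivation_atomLift, map_sub]
    simp [one_def, sub_eq_add_neg, add_comm]
  rw [Derivation.leibniz_pow, Nat.add_sub_cancel, smul_eq_mul, map_nsmul, map_mul, map_pow,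
    mapDomain_fst_atomLift, h, mul_smul_comm, ← Nat.cast_smul_eq_nsmul ℝ, smul_smul,
    mul_comm (_ ^ n)]
  push_cast
  ring_nf

/-- Lifting the walk to `G × ℤ`, the second coordinate is a centred walk with `O(n)` second moment,
and it is a derivation: its Leibniz rule produces the factor `n + 1`. -/
theorem l1_one_sub_single_mul_pow_le (a : G) {b : ℝ} (hb : 0 < b) {r : ℝ[G]} (hr : 0 ≤ r.coeff)
    (h1 : mass (single 0 b + single a b + r) = 1) (n : ℕ) :
    l1 ((1 - single a 1) * (single 0 b + single a b + r) ^ n) ≤ √(2 / b) / √((n : ℝ) + 1) := by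
  have hmass : mass (atomLift a b r) = 1 := by
    rw [mass_atomLift, ← h1, map_add, map_add, mass_single, mass_single]
  have hb' : 0 < (n + 1) * b := by positivity
  have key := (l1_mapDomain_le (AddMonoidHom.fst G ℤ) _).trans
    (l1_charDerivation_atomLift_pow_le a hb.le hr hmass (n + 1))
  rw [mapDomain_fst_charDerivation_atomLift_pow, l1_smul, abs_neg, abs_of_pos hb',
    ← le_div_iff₀' hb'] at key
  refine key.trans_eq ?_
  rw [← Real.sqrt_div (by positivity), ← Real.sqrt_sq hb'.le, ← Real.sqrt_div (by positivity)]
  congr 1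
  push_cast
  field_simp

end Coupling

section Decay

open AddMonoidAlgebra

variable {G : Type*} [AddCommGroup G] {q : ℝ[G]}

/-- A finitely supported probability measure on `G` whose support contains `0` and generates `G`,
that is, the step distribution of a lazy irreducible random walk. -/
structure IsLazyStep (q : ℝ[G]) : Prop where
  nonneg : 0 ≤ q.coeff
  mass_eq_one : mass q = 1
  coeff_zero_pos : 0 < q.coeff 0
  closure_support : AddSubgroup.closure {a | 0 < q.coeff a} = ⊤

theorem IsLazyStep.l1_pow (hq : IsLazyStep q) (n : ℕ) : l1 (q ^ n) = 1 := by
  rw [l1_eq_mass (coeff_pow_nonneg hq.nonneg n), map_pow, hq.mass_eq_one, one_pow]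

/-- Convolution with `f` acts on the powers of `q` like a finite difference operator of order `k`:
in the diffusive scaling each order gains a factor `n ^ (-1/2)` in `ℓ¹`. -/
def DecaysAtOrder (q : ℝ[G]) (k : ℕ) (f : ℝ[G]) : Prop :=
  ∃ C : ℝ, ∀ n : ℕ, l1 (f * q ^ n) ≤ C / √((n : ℝ) + 1) ^ k

theorem DecaysAtOrder.add {k : ℕ} {f g : ℝ[G]} (hf : DecaysAtOrder q k f)
    (hg : DecaysAtOrder q k g) : DecaysAtOrder q k (f + g) := by
  obtain ⟨C, hC⟩ := hf
  obtain ⟨D, hD⟩ := hg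
  refine ⟨C + D, fun n => ?_⟩
  rw [add_mul, add_div]
  exact (l1_add_le _ _).trans (add_le_add (hC n) (hD n))

theorem DecaysAtOrder.smul {k : ℕ} {f : ℝ[G]} (hf : DecaysAtOrder q k f) (c : ℝ) :
    DecaysAtOrder q k (c • f) := by
  obtain ⟨C, hC⟩ := hf
  refine ⟨|c| * C, fun n => ?_⟩
  rw [smul_mul_assoc, l1_smul, mul_div_assoc]
  exact mul_le_mul_of_nonneg_left (hC n) (abs_nonneg _)

theorem DecaysAtOrder.sum {k : ℕ} {ι : Type*} {s : Finset ι} {f : ι → ℝ[G]}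
    (hf : ∀ i ∈ s, DecaysAtOrder q k (f i)) : DecaysAtOrder q k (∑ i ∈ s, f i) :=
  Finset.sum_induction f _ (fun _ _ => .add) ⟨0, fun n => by simp⟩ hf

theorem div_sqrt_pow_le {C : ℝ} (hC : 0 ≤ C) (k : ℕ) {m n : ℕ} (h : n ≤ 2 * m + 1) :
    C / √((m : ℝ) + 1) ^ k ≤ C * √2 ^ k / √((n : ℝ) + 1) ^ k := by
  have hmn : √((n : ℝ) + 1) ≤ √2 * √((m : ℝ) + 1) := by
    rw [← Real.sqrt_mul zero_le_two]
    refine Real.sqrt_le_sqrt ?_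
    have : (n : ℝ) ≤ 2 * m + 1 := by exact_mod_cast h
    linarith
  rw [div_le_div_iff₀ (by positivity) (by positivity), mul_assoc, ← mul_pow]
  gcongr

theorem DecaysAtOrder.mul {j k : ℕ} {f g : ℝ[G]} (hf : DecaysAtOrder q j f)
    (hg : DecaysAtOrder q k g) : DecaysAtOrder q (j + k) (f * g) := by
  obtain ⟨C, hC⟩ := hf
  obtain ⟨D, hD⟩ := hg
  have hC0 : 0 ≤ C := (l1_nonneg _).trans (by simpa using hC 0)
  have hD0 : 0 ≤ D := (l1_nonneg _).trans (by simpa using hD 0)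
  refine ⟨C * √2 ^ j * (D * √2 ^ k), fun n => ?_⟩
  have split_time : f * g * q ^ n = f * q ^ (n / 2) * (g * q ^ (n - n / 2)) := by
    conv_lhs => rw [show n = n / 2 + (n - n / 2) by omega, pow_add]
    ring
  rw [split_time, pow_add, mul_div_mul_comm]
  exact (l1_mul_le _ _).trans (mul_le_mul ((hC _).trans (div_sqrt_pow_le hC0 j (by omega)))
    ((hD _).trans (div_sqrt_pow_le hD0 k (by omega))) (l1_nonneg _) (by positivity))

theorem decaysAtOrder_zero (hq : IsLazyStep q) (f : ℝ[G]) : DecaysAtOrder q 0 f :=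
  ⟨l1 f, fun n => by simpa [hq.l1_pow] using l1_mul_le f (q ^ n)⟩

theorem DecaysAtOrder.mul_left {k : ℕ} {f : ℝ[G]} (hf : DecaysAtOrder q k f)
    (hq : IsLazyStep q) (g : ℝ[G]) : DecaysAtOrder q k (g * f) := by
  simpa only [zero_add] using (decaysAtOrder_zero hq g).mul hf

theorem decaysAtOrder_one_sub_single (hq : IsLazyStep q) {a : G} (ha : 0 < q.coeff a) :
    DecaysAtOrder q 1 (1 - single a 1) := by
  classical
  rcases eq_or_ne a 0 with rfl | hne
  · exact ⟨0, fun n => by rw [one_def, sub_self]; simp⟩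
  obtain ⟨b, hb⟩ : ∃ b, b = min (q.coeff 0) (q.coeff a) := ⟨_, rfl⟩
  have hr : 0 ≤ (q - single 0 b - single a b).coeff := fun x => by
    have hx := hq.nonneg x
    simp only [coeff_sub, coeff_single, Finsupp.sub_apply, Finsupp.single_apply,
      Finsupp.zero_apply] at hx ⊢
    split_ifs with hx0 hxa hxa
    · exact absurd (hxa.trans hx0.symm) hne
    · simp [hb, ← hx0]
    · simp [hb, ← hxa]
    · simpa using hx
  have hsum : single 0 b + single a b + (q - single 0 b - single a b) = q := by abel
  refine ⟨√(2 / b), fun n => ?_⟩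
  have key := l1_one_sub_single_mul_pow_le a (hb ▸ lt_min hq.coeff_zero_pos ha) hr
    (by rw [hsum, hq.mass_eq_one]) n
  rwa [hsum, ← pow_one √((n : ℝ) + 1)] at key

theorem decaysAtOrder_one_of_mass_eq_zero (hq : IsLazyStep q) {f : ℝ[G]} (hf : mass f = 0) :
    DecaysAtOrder q 1 f := by
  have translation (a : G) : DecaysAtOrder q 1 (1 - single a 1) := by
    have ha : a ∈ AddSubgroup.closure {a | 0 < q.coeff a} :=
      hq.closure_support ▸ AddSubgroup.mem_top a
    induction ha using AddSubgroup.closure_induction with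
    | mem a ha => exact decaysAtOrder_one_sub_single hq ha
    | zero => exact ⟨0, fun n => by rw [one_def, sub_self]; simp⟩
    | add a b _ _ iha ihb =>
      have h : (1 : ℝ[G]) - single (a + b) 1 = 1 - single a 1 + single a 1 * (1 - single b 1) := by
        rw [mul_sub, single_mul_single]; simp
      rw [h]
      exact iha.add (ihb.mul_left hq _)
    | neg a _ ih =>
      have h : (1 : ℝ[G]) - single (-a) 1 = -single (-a) 1 * (1 - single a 1) := by
        rw [neg_mul, mul_sub, single_mul_single, mul_one, neg_add_cancel, mul_one, ← one_def,
          neg_sub]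
      rw [h]
      exact ih.mul_left hq _
  have hsum : f = ∑ x ∈ f.coeff.support, (-f.coeff x) • (1 - single x (1 : ℝ)) := by
    simp only [smul_sub, Finset.sum_sub_distrib, neg_smul, Finset.sum_neg_distrib,
      sum_coeff_smul_single, ← Finset.sum_smul, ← mass_eq_sum, hf]
    simp
  rw [hsum]
  exact .sum fun x _ => (translation x).smul _

end Decay

section HeatKernel

open AddMonoidAlgebra

variable {G : Type*} [AddCommGroup G] {q : ℝ[G]}

theorem decaysAtOrder_of_mem_pow (hq : IsLazyStep q) {k : ℕ} {f : ℝ[G]}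
    (hf : f ∈ RingHom.ker (mass (G := G)) ^ k) : DecaysAtOrder q k f := by
  induction k generalizing f with
  | zero => exact decaysAtOrder_zero hq f
  | succ k ih =>
    rw [pow_succ] at hf
    induction hf using Submodule.mul_induction_on' with
    | mem_mul_mem g hg h hh => exact (ih hg).mul (decaysAtOrder_one_of_mass_eq_zero hq hh)
    | add g _ h _ hg hh => exact hg.add hh

theorem derivation_mem_ideal_pow {A : Type*} [CommRing A] [Algebra ℝ A] (D : Derivation ℝ A A)
    {I : Ideal A} {k : ℕ} {f : A} (hf : f ∈ I ^ k) : D f ∈ I ^ (k - 1) := by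
  rcases k with _ | k
  · simp
  rw [Nat.add_sub_cancel]
  induction k generalizing f with
  | zero => simp
  | succ k ih =>
    rw [pow_succ] at hf
    induction hf using Submodule.mul_induction_on' with
    | mem_mul_mem g hg h hh =>
      rw [D.leibniz, smul_eq_mul, smul_eq_mul]
      refine add_mem (Ideal.mul_mem_right _ _ hg) ?_
      rw [pow_succ']
      exact Ideal.mul_mem_mul hh (ih hg)
    | add g _ h _ hg hh => rw [map_add]; exact add_mem hg hh

theorem iterate_charDerivation_succ_mul_pow (χ : G →+ ℝ) (j n : ℕ) (f : ℝ[G]) :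
    (charDerivation χ)^[j + 1] (f * q ^ n) =
      (charDerivation χ)^[j] (charDerivation χ f * q ^ n) +
        n • (charDerivation χ)^[j] (f * charDerivation χ q * q ^ (n - 1)) := by
  rw [← iterate_map_nsmul, ← iterate_map_add, Function.iterate_succ_apply, Derivation.leibniz,
    Derivation.leibniz_pow]
  congr 1
  simp only [smul_eq_mul, nsmul_eq_mul]
  ring

/-- Each application of a centred character derivation costs at most one order of decay: it either
lowers the order of `f`, or it hits one of the `n` factors `q` and raises the order of `f`. -/
theorem exists_l1_mul_iterate_charDerivation_le (hq : IsLazyStep q) {χ : G →+ ℝ}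
    (hχ : mass (charDerivation χ q) = 0) {m : ℕ} {g : ℝ[G]}
    (hg : g ∈ RingHom.ker (mass (G := G)) ^ m) (j : ℕ) {k : ℕ} {f : ℝ[G]}
    (hf : f ∈ RingHom.ker (mass (G := G)) ^ k) (hj : j ≤ m + k) :
    ∃ C : ℝ, ∀ n : ℕ, l1 (g * (charDerivation χ)^[j] (f * q ^ n)) ≤
      C / √((n : ℝ) + 1) ^ (m + k - j) := by
  induction j generalizing k f with
  | zero =>
    obtain ⟨C, hC⟩ := decaysAtOrder_of_mem_pow hq (pow_add (RingHom.ker (mass (G := G))) m k ▸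
      Ideal.mul_mem_mul hg hf)
    exact ⟨C, fun n => by simpa [mul_assoc] using hC n⟩
  | succ j ih =>
    obtain ⟨C₁, hC₁⟩ := ih (derivation_mem_ideal_pow (charDerivation χ) hf) (by omega)
    obtain ⟨C₂, hC₂⟩ := ih (k := k + 1) (pow_succ (RingHom.ker (mass (G := G))) k ▸
      Ideal.mul_mem_mul hf hχ) (by omega)
    have hC₁0 : 0 ≤ C₁ := (l1_nonneg _).trans (by simpa using hC₁ 0)
    have hC₂0 : 0 ≤ C₂ := (l1_nonneg _).trans (by simpa using hC₂ 0)
    refine ⟨C₁ + C₂ * √2 ^ (m + k - (j + 1)), fun n => ?_⟩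
    rw [iterate_charDerivation_succ_mul_pow, mul_add, add_div]
    refine (l1_add_le _ _).trans (add_le_add ((hC₁ n).trans ?_) ?_)
    · refine div_le_div_of_nonneg_left hC₁0 (by positivity)
        (pow_le_pow_right₀ (Real.one_le_sqrt.2 (by simp)) (by omega))
    rcases n with _ | n
    · simpa using by positivity
    rw [Nat.add_sub_cancel, mul_smul_comm, ← Nat.cast_smul_eq_nsmul ℝ, l1_smul, Nat.abs_cast]
    calc ((n + 1 : ℕ) : ℝ) * l1 (g * (charDerivation χ)^[j] (f * charDerivation χ q * q ^ n))
        ≤ √((n : ℝ) + 1) ^ 2 * (C₂ / √((n : ℝ) + 1) ^ (m + k - (j + 1) + 2)) := by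
          rw [Real.sq_sqrt (by positivity), show m + k - (j + 1) + 2 = m + (k + 1) - j by omega]
          push_cast
          gcongr
          exact hC₂ n
      _ = C₂ / √((n : ℝ) + 1) ^ (m + k - (j + 1)) := by
          have : √((n : ℝ) + 1) ≠ 0 := (Real.sqrt_pos.2 (by positivity)).ne'
          rw [pow_add]; field_simp
      _ ≤ _ := div_sqrt_pow_le hC₂0 _ (by omega)

theorem pairing_one_sub_single_mul (h : G → ℝ) (a : G) (f : ℝ[G]) :
    pairing h ((1 - single a 1) * f) = pairing (fun x => h x - h (a + x)) f := by
  induction f using AddMonoidAlgebra.induction_linear with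
  | zero => simp
  | add f g hf hg => simp [mul_add, hf, hg]
  | single m r => simp [sub_mul, single_mul_single, mul_sub]

variable {d : ℕ}

/-- The finite difference operator in all coordinate directions, `∂₁ ⋯ ∂_d`. -/
def mixedGradient (d : ℕ) : ℝ[Site d] := ∏ k, (1 - single (Pi.single k 1) 1)

theorem mixedGradient_mem (d : ℕ) :
    mixedGradient d ∈ RingHom.ker (mass (G := Site d)) ^ d := by
  have h := Ideal.prod_mem_prod (I := fun _ => RingHom.ker (mass (G := Site d)))
    (x := fun k : Fin d => 1 - single (Pi.single k 1) 1) (s := Finset.univ)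
    fun k _ => by simp
  simpa [mixedGradient] using h

/-- Integrates the mixed difference in the directions of `s` back over a quadrant at `z`. -/
theorem coeff_eq_pairing_prod_one_sub_single (f : ℝ[Site d]) (z : Site d) (s : Finset (Fin d)) :
    f.coeff z = pairing (fun x => if (∀ k ∈ s, x k ≤ z k) ∧ ∀ k ∉ s, x k = z k then 1 else 0)
      ((∏ k ∈ s, (1 - single (Pi.single k 1) 1)) * f) := by
  classical
  induction s using Finset.induction_on with
  | empty =>
    have h (x : Site d) : (∀ k, x k = z k) ↔ x = z := funext_iff.symm
    rw [pairing_eq_sum]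
    simp +contextual [h, Finset.sum_ite_eq']
  | insert k s hk ih =>
    rw [ih, Finset.prod_insert hk, mul_assoc, pairing_one_sub_single_mul]
    congr 2
    funext x
    have rest (y : Site d) (hy : ∀ j ≠ k, y j = x j) :
        ((∀ j ∈ insert k s, y j ≤ z j) ∧ ∀ j ∉ insert k s, y j = z j) ↔
          y k ≤ z k ∧ (∀ j ∈ s, x j ≤ z j) ∧ ∀ j ∉ insert k s, x j = z j := by
      grind
    have here : ((∀ j ∈ s, x j ≤ z j) ∧ ∀ j ∉ s, x j = z j) ↔
        x k = z k ∧ (∀ j ∈ s, x j ≤ z j) ∧ ∀ j ∉ insert k s, x j = z j := by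
      grind
    rw [if_congr here rfl rfl, if_congr (rest x fun _ _ => rfl) rfl rfl,
      if_congr (rest (Pi.single k 1 + x) fun j hj => by simp [Pi.single_eq_of_ne hj]) rfl rfl,
      Pi.add_apply, Pi.single_eq_same]
    grind

/-- A discrete Sobolev inequality. -/
theorem abs_coeff_le_l1_mixedGradient_mul (f : ℝ[Site d]) (z : Site d) :
    |f.coeff z| ≤ l1 (mixedGradient d * f) := by
  rw [coeff_eq_pairing_prod_one_sub_single f z Finset.univ]
  exact abs_pairing_le (fun x => by split_ifs <;> simp) _

/-- The `k`-th coordinate, as a real-valued additive character of `ℤ^d`. -/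
def coordChar (k : Fin d) : Site d →+ ℝ :=
  (Int.castAddHom ℝ).comp (Pi.evalAddMonoidHom (fun _ => ℤ) k)

@[simp] theorem coordChar_apply (k : Fin d) (x : Site d) : coordChar k x = x k := rfl

theorem exists_abs_pow_mul_coeff_le {q : ℝ[Site d]} (hq : IsLazyStep q) {i : Fin d}
    (hi : mass (charDerivation (coordChar i) q) = 0) {k : ℕ} {f : ℝ[Site d]}
    (hf : f ∈ RingHom.ker (mass (G := Site d)) ^ k) {j : ℕ} (hj : j ≤ d + k) :
    ∃ C : ℝ, ∀ (n : ℕ) (z : Site d), |(z i : ℝ)| ^ j * |(f * q ^ n).coeff z| ≤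
      C / √((n : ℝ) + 1) ^ (d + k - j) := by
  obtain ⟨C, hC⟩ := exists_l1_mul_iterate_charDerivation_le hq hi (mixedGradient_mem d) j hf hj
  refine ⟨C, fun n z => le_trans ?_ (hC n)⟩
  rw [← coordChar_apply, ← abs_pow, ← abs_mul, ← coeff_iterate_charDerivation]
  exact abs_coeff_le_l1_mixedGradient_mul _ z

end HeatKernel

section LazyWalk

open AddMonoidAlgebra

/-- The pushforward of the group algebra under `x ↦ -x`. -/
def reflect {G : Type*} [AddCommGroup G] : ℝ[G] →ₐ[ℝ] ℝ[G] :=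
  mapDomainAlgHom ℝ ℝ (negAddMonoidHom : G →+ G)

@[simp] theorem reflect_single {G : Type*} [AddCommGroup G] (x : G) (c : ℝ) :
    reflect (single x c) = single (-x) c := by
  simp [reflect]

theorem mass_charDerivation_reflect {G : Type*} [AddCommGroup G] (χ : G →+ ℝ) (f : ℝ[G]) :
    mass (charDerivation χ (reflect f)) = -mass (charDerivation χ f) := by
  induction f using AddMonoidAlgebra.induction_linear with
  | zero => simp
  | add f g hf hg => simp only [map_add, hf, hg, neg_add]
  | single x c => simp

variable {d : ℕ}

/-- The nearest neighbours of the origin in `ℤ^d`, i.e. the signed unit vectors. -/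
def neighbors (d : ℕ) : Finset (Site d) :=
  Finset.univ.image fun s : Fin d × ℤˣ => Pi.single s.1 (s.2 : ℤ)

theorem single_mem_neighbors (k : Fin d) : (Pi.single k 1 : Site d) ∈ neighbors d :=
  Finset.mem_image.2 ⟨(k, 1), by simp⟩

theorem mem_neighbors {y : Site d} : y ∈ neighbors d ↔ ∑ k, |y k| = 1 := by
  constructor
  · simp only [neighbors, Finset.mem_image, Finset.mem_univ, true_and]
    rintro ⟨⟨k, s⟩, rfl⟩
    rw [Finset.sum_eq_single k (by simp +contextual) (by simp)]
    simpa using Int.isUnit_iff_abs_eq.1 s.isUnit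
  · intro h
    obtain ⟨k, hk⟩ : ∃ k, y k ≠ 0 := by
      by_contra! h0
      simp [h0] at h
    have hy (j : Fin d) (hj : j ≠ k) : y j = 0 := by
      by_contra h0
      have := Finset.add_le_sum (f := fun k => |y k|) (s := Finset.univ) (fun _ _ => abs_nonneg _)
        (Finset.mem_univ j) (Finset.mem_univ k) hj
      have := Int.one_le_abs hk
      have := Int.one_le_abs h0
      omega
    rw [Finset.sum_eq_single k (by simp +contextual [hy]) (by simp)] at h
    refine Finset.mem_image.2 ⟨(k, (Int.isUnit_iff_abs_eq.2 h).unit), Finset.mem_univ _, ?_⟩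
    ext j
    rcases eq_or_ne j k with rfl | hj
    · simp
    · simp [hj, hy j hj]

theorem card_neighbors (d : ℕ) : (neighbors d).card = 2 * d := by
  rw [neighbors, Finset.card_image_of_injective]
  · simp [Fintype.card_units_int, mul_comm]
  · rintro ⟨j, s⟩ ⟨k, t⟩ h
    have hj := congrFun h j
    rcases eq_or_ne j k with rfl | hjk
    · simpa [Units.ext_iff] using hj
    · simp [hjk] at hj

theorem neg_mem_neighbors {y : Site d} : -y ∈ neighbors d ↔ y ∈ neighbors d := by
  simp [mem_neighbors]

theorem zero_notMem_neighbors : (0 : Site d) ∉ neighbors d := by simp [mem_neighbors]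

/-- The transition kernel of the simple random walk which stays put with probability `1 / 2`, as an
element of the group algebra. -/
def lazyWalk (d : ℕ) : ℝ[Site d] :=
  single 0 (1 / 2 : ℝ) + ∑ y ∈ neighbors d, single y (1 / (4 * d : ℝ))

theorem reflect_lazyWalk : reflect (lazyWalk d) = lazyWalk d := by
  rw [lazyWalk, map_add, map_sum]
  simp only [reflect_single, neg_zero]
  congr 1
  exact Finset.sum_nbij' (fun y => -y) (fun y => -y) (fun y hy => neg_mem_neighbors.2 hy)
    (fun y hy => neg_mem_neighbors.2 hy) (by simp) (by simp) (by simp)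

theorem mass_charDerivation_lazyWalk (χ : Site d →+ ℝ) :
    mass (charDerivation χ (lazyWalk d)) = 0 := by
  have h := mass_charDerivation_reflect χ (lazyWalk d)
  rw [reflect_lazyWalk] at h
  linarith

theorem isLazyStep_lazyWalk [NeZero d] : IsLazyStep (lazyWalk d) := by
  have hd : (0 : ℝ) < d := Nat.cast_pos.2 (NeZero.pos d)
  have coeff_zero_le (x : Site d) :
      (single (0 : Site d) (1 / 2 : ℝ)).coeff x ≤ (lazyWalk d).coeff x := by
    rw [lazyWalk, coeff_add, coeff_sum, Finsupp.add_apply]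
    exact le_add_of_nonneg_right (Finset.sum_nonneg (fun y _ => coeff_single_nonneg y
      (by positivity : (0 : ℝ) ≤ 1 / (4 * d))) x)
  refine ⟨fun x => (coeff_single_nonneg 0 (by norm_num) x).trans (coeff_zero_le x), ?_,
    (coeff_zero_le 0).trans_lt' (by simp), ?_⟩
  · simp only [lazyWalk, map_add, map_sum, mass_single, Finset.sum_const, card_neighbors,
      nsmul_eq_mul]
    push_cast
    field_simp
    norm_num
  · have unit_mem (k : Fin d) :
        (Pi.single k 1 : Site d) ∈ AddSubgroup.closure {a | 0 < (lazyWalk d).coeff a} := by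
      refine AddSubgroup.subset_closure ?_
      simp only [Set.mem_ofPred_eq, lazyWalk, coeff_add, coeff_sum, Finsupp.add_apply,
        Finsupp.finsetSum_apply, coeff_single, Finsupp.single_apply, Finset.sum_ite_eq',
        single_mem_neighbors, if_true]
      positivity
    refine (AddSubgroup.eq_top_iff' _).2 fun x => ?_
    rw [← Finset.univ_sum_single x]
    refine sum_mem fun k _ => ?_
    have h : (Pi.single k (x k) : Site d) = x k • Pi.single k 1 := by
      rw [← Pi.single_smul]; simp
    rw [h]
    exact AddSubgroup.zsmul_mem _ (unit_mem k) _

end LazyWalk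

section TimeSums

theorem sum_Ico_sum_Ico_add_le {F : ℕ → ℝ} (hF : ∀ m, 0 ≤ F m) (M N : ℕ) :
    ∑ k ∈ Finset.Ico M N, ∑ l ∈ Finset.Ico M N, F (k + l) ≤
      ∑ m ∈ Finset.Ico M (2 * N), ((m : ℝ) + 1) * F m := by
  rw [← Finset.sum_product', ← Finset.sum_fiberwise_of_maps_to (t := Finset.Ico M (2 * N))
    (g := fun x : ℕ × ℕ => x.1 + x.2) (fun x hx => by
      simp only [Finset.mem_product, Finset.mem_Ico] at hx ⊢; omega)]
  refine Finset.sum_le_sum fun m _ => ?_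
  rw [Finset.sum_congr rfl fun x hx => by rw [(Finset.mem_filter.1 hx).2], Finset.sum_const,
    nsmul_eq_mul]
  refine mul_le_mul_of_nonneg_right ?_ (hF m)
  rw [← Nat.cast_add_one, Nat.cast_le, ← Finset.Nat.card_antidiagonal m]
  exact Finset.card_le_card fun x hx => by simpa using (Finset.mem_filter.1 hx).2

theorem inv_sqrt_cube_le_sub (m : ℕ) :
    1 / √((m : ℝ) + 1) ^ 3 ≤ 4 / √((m : ℝ) + 1) - 4 / √(((m + 1 : ℕ) : ℝ) + 1) := by
  have ht : 0 < √((m : ℝ) + 1) := Real.sqrt_pos.2 (by positivity)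
  have hs : 0 < √(((m + 1 : ℕ) : ℝ) + 1) := Real.sqrt_pos.2 (by positivity)
  have ht2 : √((m : ℝ) + 1) ^ 2 = m + 1 := Real.sq_sqrt (by positivity)
  have hs2 : √(((m + 1 : ℕ) : ℝ) + 1) ^ 2 = m + 1 + 1 := by
    rw [Real.sq_sqrt (by positivity)]; push_cast; ring
  set t := √((m : ℝ) + 1)
  set s := √(((m + 1 : ℕ) : ℝ) + 1)
  have hst : s ≤ 3 / 2 * t := le_of_sq_le_sq (by nlinarith) (by positivity)
  have hdiff : 4 / t - 4 / s = 4 / (s * t * (s + t)) := by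
    have : (s - t) * (s + t) = 1 := by linear_combination hs2 - ht2
    field_simp
    linarith
  rw [hdiff, div_le_div_iff₀ (by positivity) (by positivity)]
  calc 1 * (s * t * (s + t)) ≤ 1 * (3 / 2 * t * t * (3 / 2 * t + t)) := by gcongr
    _ ≤ 4 * t ^ 3 := by nlinarith [pow_pos ht 3]

theorem sum_Ico_inv_sqrt_pow_le {d : ℕ} (hd : 3 ≤ d) (M N : ℕ) :
    ∑ m ∈ Finset.Ico M N, 1 / √((m : ℝ) + 1) ^ d ≤ 4 / √((M : ℝ) + 1) ^ (d - 2) := by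
  have telescope : ∑ m ∈ Finset.Ico M N, 1 / √((m : ℝ) + 1) ^ 3 ≤ 4 / √((M : ℝ) + 1) := by
    rcases le_total M N with h | h
    · refine (Finset.sum_le_sum fun m _ => inv_sqrt_cube_le_sub m).trans ?_
      rw [← neg_le_neg_iff, ← Finset.sum_neg_distrib]
      simp only [neg_sub]
      rw [Finset.sum_Ico_sub (fun m : ℕ => 4 / √((m : ℝ) + 1)) h]
      linarith [show 0 ≤ 4 / √((N : ℝ) + 1) by positivity]
    · rw [Finset.Ico_eq_empty_of_le h, Finset.sum_empty]
      positivity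
  obtain ⟨j, rfl⟩ := Nat.exists_eq_add_of_le hd
  calc ∑ m ∈ Finset.Ico M N, 1 / √((m : ℝ) + 1) ^ (3 + j)
      ≤ ∑ m ∈ Finset.Ico M N, 1 / √((M : ℝ) + 1) ^ j * (1 / √((m : ℝ) + 1) ^ 3) := by
        refine Finset.sum_le_sum fun m hm => ?_
        have hMm : (M : ℝ) ≤ m := Nat.cast_le.2 (Finset.mem_Ico.1 hm).1
        rw [one_div_mul_one_div, mul_comm, pow_add]
        gcongr
    _ ≤ 1 / √((M : ℝ) + 1) ^ j * (4 / √((M : ℝ) + 1)) := by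
        rw [← Finset.mul_sum]
        gcongr
    _ = 4 / √((M : ℝ) + 1) ^ (3 + j - 2) := by
        rw [show 3 + j - 2 = j + 1 by omega, pow_succ, div_mul_div_comm, one_mul]

theorem add_one_mul_le_div_sqrt_pow {F : ℕ → ℝ} {C : ℝ} {k : ℕ}
    (h : ∀ m : ℕ, F m ≤ C / √((m : ℝ) + 1) ^ (k + 2)) (m : ℕ) :
    ((m : ℝ) + 1) * F m ≤ C / √((m : ℝ) + 1) ^ k := by
  have hm : (0 : ℝ) < m + 1 := by positivity
  calc ((m : ℝ) + 1) * F m ≤ (m + 1) * (C / √((m : ℝ) + 1) ^ (k + 2)) := by gcongr; exact h m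
    _ = _ := by
      have : √((m : ℝ) + 1) ≠ 0 := (Real.sqrt_pos.2 hm).ne'
      rw [pow_add, Real.sq_sqrt hm.le]
      field_simp

theorem sum_Ico_add_one_mul_le {d : ℕ} (hd : 3 ≤ d) {F : ℕ → ℝ} {C : ℝ} (hF : ∀ m, 0 ≤ F m)
    (h : ∀ m : ℕ, F m ≤ C / √((m : ℝ) + 1) ^ (d + 2)) (M N : ℕ) :
    ∑ m ∈ Finset.Ico M N, ((m : ℝ) + 1) * F m ≤ 4 * C / √((M : ℝ) + 1) ^ (d - 2) := by
  have hC : 0 ≤ C := (hF 0).trans (by simpa using h 0)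
  calc ∑ m ∈ Finset.Ico M N, ((m : ℝ) + 1) * F m
      ≤ ∑ m ∈ Finset.Ico M N, C * (1 / √((m : ℝ) + 1) ^ d) :=
        Finset.sum_le_sum fun m _ => by
          rw [mul_one_div]; exact add_one_mul_le_div_sqrt_pow h m
    _ ≤ C * (4 / √((M : ℝ) + 1) ^ (d - 2)) := by
        rw [← Finset.mul_sum]
        exact mul_le_mul_of_nonneg_left (sum_Ico_inv_sqrt_pow_le hd M N) hC
    _ = _ := by ring

/-- The diffusive time scale `R ^ 2` splits the sum: before it the decay in `R` is used, after it
the decay in time. -/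
theorem sum_range_sum_range_add_mul_pow_le {d : ℕ} (hd : 3 ≤ d) {F : ℕ → ℝ} {C R : ℝ}
    (hF : ∀ m, 0 ≤ F m) (hR : 0 ≤ R)
    (htime : ∀ m : ℕ, F m ≤ C / √((m : ℝ) + 1) ^ (d + 2))
    (hspace : ∀ m : ℕ, R ^ d * F m ≤ C / √((m : ℝ) + 1) ^ 2) (n : ℕ) :
    (∑ k ∈ Finset.range n, ∑ l ∈ Finset.range n, F (k + l)) * R ^ (d - 2) ≤ 5 * C := by
  have hC : 0 ≤ C := (hF 0).trans (by simpa using htime 0)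
  rcases hR.eq_or_lt with rfl | hR0
  · rw [zero_pow (by omega), mul_zero]; positivity
  set N : ℕ := ⌊R ^ 2⌋₊
  have hg (m : ℕ) : 0 ≤ ((m : ℝ) + 1) * F m := mul_nonneg (by positivity) (hF m)
  have hRd : R ^ d = R ^ 2 * R ^ (d - 2) := by rw [← pow_add, Nat.add_sub_cancel' (by omega)]
  have head : ∑ m ∈ Finset.Ico 0 N, ((m : ℝ) + 1) * F m ≤ C / R ^ (d - 2) := by
    have hterm (m : ℕ) : ((m : ℝ) + 1) * F m ≤ C / R ^ d := by
      rw [le_div_iff₀ (by positivity), mul_comm, mul_left_comm]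
      simpa using add_one_mul_le_div_sqrt_pow (k := 0) hspace m
    calc ∑ m ∈ Finset.Ico 0 N, ((m : ℝ) + 1) * F m ≤ N * (C / R ^ d) := by
          simpa using Finset.sum_le_card_nsmul (Finset.Ico 0 N) _ _ fun m _ => hterm m
      _ ≤ R ^ 2 * (C / R ^ d) := by
          gcongr; exact Nat.floor_le (by positivity)
      _ = C / R ^ (d - 2) := by rw [hRd]; field_simp
  have tail : ∑ m ∈ Finset.Ico N (N + 2 * n), ((m : ℝ) + 1) * F m ≤ 4 * C / R ^ (d - 2) := by
    refine (sum_Ico_add_one_mul_le hd hF htime N _).trans ?_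
    gcongr
    exact Real.le_sqrt_of_sq_le (Nat.lt_floor_add_one _).le
  rw [← le_div_iff₀ (by positivity), Finset.range_eq_Ico]
  calc _ ≤ ∑ m ∈ Finset.Ico 0 (2 * n), ((m : ℝ) + 1) * F m := sum_Ico_sum_Ico_add_le hF 0 n
    _ ≤ ∑ m ∈ Finset.Ico 0 (N + 2 * n), ((m : ℝ) + 1) * F m :=
        Finset.sum_le_sum_of_subset_of_nonneg (Finset.Ico_subset_Ico le_rfl (by omega))
          fun m _ _ => hg m
    _ ≤ C / R ^ (d - 2) + 4 * C / R ^ (d - 2) := by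
        rw [← Finset.sum_Ico_consecutive _ (Nat.zero_le N) (Nat.le_add_right N _)]
        exact add_le_add head tail
    _ = 5 * C / R ^ (d - 2) := by ring

end TimeSums

section Green

open AddMonoidAlgebra

variable {d : ℕ}

theorem siteDist_pow_le [NeZero d] (x y : Site d) (n : ℕ) :
    siteDist x y ^ n ≤ √d ^ n * ∑ k, |((y - x) k : ℝ)| ^ n := by
  obtain ⟨k, -, hk⟩ := Finset.exists_max_image Finset.univ (fun k => |((y - x) k : ℝ)|)
    Finset.univ_nonempty
  have hdist : siteDist x y ≤ √d * |((y - x) k : ℝ)| := by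
    rw [siteDist, Real.sqrt_le_left (by positivity), mul_pow, Real.sq_sqrt (by positivity)]
    have h := Finset.sum_le_card_nsmul Finset.univ (fun k => ((x k : ℝ) - y k) ^ 2)
      (|((y - x) k : ℝ)| ^ 2) fun j hj => by
        rw [← sq_abs, abs_sub_comm, ← Int.cast_sub, ← Pi.sub_apply]
        exact pow_le_pow_left₀ (abs_nonneg _) (hk j hj) 2
    simpa using h
  calc siteDist x y ^ n ≤ (√d * |((y - x) k : ℝ)|) ^ n :=
        pow_le_pow_left₀ (Real.sqrt_nonneg _) hdist n
    _ ≤ _ := by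
        rw [mul_pow]
        gcongr
        exact Finset.single_le_sum (f := fun k => |((y - x) k : ℝ)| ^ n)
          (fun _ _ => by positivity) (Finset.mem_univ k)

theorem exists_coeff_mul_lazyWalk_pow_le [NeZero d] {k : ℕ} {f : ℝ[Site d]}
    (hf : f ∈ RingHom.ker (mass (G := Site d)) ^ k) :
    ∃ C : ℝ, ∀ (n : ℕ) (x y : Site d),
      |(f * lazyWalk d ^ n).coeff (y - x)| ≤ C / √((n : ℝ) + 1) ^ (d + k) ∧
      siteDist x y ^ d * |(f * lazyWalk d ^ n).coeff (y - x)| ≤ C / √((n : ℝ) + 1) ^ k := by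
  obtain ⟨A, hA⟩ := exists_abs_pow_mul_coeff_le isLazyStep_lazyWalk
    (mass_charDerivation_lazyWalk (coordChar 0)) hf (j := 0) (by omega)
  choose B hB using fun i => exists_abs_pow_mul_coeff_le isLazyStep_lazyWalk
    (mass_charDerivation_lazyWalk (coordChar i)) hf (j := d) (by omega)
  simp only [pow_zero, one_mul, Nat.sub_zero] at hA
  simp only [Nat.add_sub_cancel_left] at hB
  refine ⟨max A (√d ^ d * ∑ i, B i), fun n x y => ⟨(hA n _).trans ?_, ?_⟩⟩
  · gcongr
    exact le_max_left _ _
  · calc _ ≤ √d ^ d * (∑ i, |((y - x) i : ℝ)| ^ d) * |(f * lazyWalk d ^ n).coeff (y - x)| := by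
          gcongr; exact siteDist_pow_le x y d
      _ ≤ √d ^ d * ∑ i, B i / √((n : ℝ) + 1) ^ k := by
          rw [mul_assoc, Finset.sum_mul]
          gcongr with i
          exact hB i n _
      _ ≤ _ := by
          rw [← Finset.sum_div, ← mul_div_assoc]
          gcongr
          exact le_max_right _ _

/-- The second difference operator `∂_a ∂_b`. -/
def doubleGradient (a b : Site d) : ℝ[Site d] := (1 - single a 1) * (1 - single b 1)

theorem doubleGradient_mem (a b : Site d) :
    doubleGradient a b ∈ RingHom.ker (mass (G := Site d)) ^ 2 := by
  rw [sq]
  exact Ideal.mul_mem_mul (by simp) (by simp)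

/-- The gradient in the direction `a` of the Green function of the lazy walk, restricted to the
times in `s`. -/
def greenGradient (a : Site d) (s : Finset ℕ) : ℝ[Site d] :=
  (1 / 2 : ℝ) • ((1 - single a 1) * ∑ k ∈ s, lazyWalk d ^ k)

theorem mass_greenGradient (a : Site d) (s : Finset ℕ) : mass (greenGradient a s) = 0 := by
  simp [greenGradient]

theorem greenGradient_range_sub (a : Site d) {m n : ℕ} (hmn : m ≤ n) :
    greenGradient a (Finset.range n) - greenGradient a (Finset.range m) =
      greenGradient a (Finset.Ico m n) := by
  rw [greenGradient, greenGradient, greenGradient, ← smul_sub, ← mul_sub,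
    Finset.sum_Ico_eq_sub _ hmn]

theorem greenGradient_mul_reflect (a b : Site d) (s t : Finset ℕ) :
    greenGradient a s * reflect (greenGradient b t) =
      (1 / 4 : ℝ) • ∑ k ∈ s, ∑ l ∈ t, doubleGradient a (-b) * lazyWalk d ^ (k + l) := by
  have h : reflect (1 - single b 1) = (1 - single (-b) 1 : ℝ[Site d]) := by simp
  simp only [greenGradient, map_smul, map_mul, h, map_sum, map_pow, reflect_lazyWalk,
    smul_mul_smul_comm, doubleGradient, pow_add, ← Finset.mul_sum]
  congr 1
  · norm_num
  · rw [mul_mul_mul_comm, Finset.sum_mul_sum]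
    simp only [Finset.mul_sum]

theorem abs_coeff_greenGradient_mul_reflect_le (a b : Site d) (s t : Finset ℕ) (z : Site d) :
    |(greenGradient a s * reflect (greenGradient b t)).coeff z| ≤
      ∑ k ∈ s, ∑ l ∈ t, |(doubleGradient a (-b) * lazyWalk d ^ (k + l)).coeff z| := by
  simp only [greenGradient_mul_reflect, coeff_smul, Finsupp.smul_apply, smul_eq_mul, abs_mul,
    coeff_sum, Finsupp.finsetSum_apply]
  refine (mul_le_of_le_one_left (abs_nonneg _) (by norm_num [abs_le])).trans
    ((Finset.abs_sum_le_sum_abs _ _).trans (Finset.sum_le_sum fun k _ => ?_))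
  exact Finset.abs_sum_le_sum_abs _ _

theorem exists_greenGradient_covariance_le (hd : 3 ≤ d) (a b : Site d) :
    ∃ K : ℝ, ∀ (n : ℕ) (x y : Site d),
      |(greenGradient a (Finset.range n) * reflect (greenGradient b (Finset.range n))).coeff
        (y - x)| * siteDist x y ^ (d - 2) ≤ K := by
  have : NeZero d := ⟨by omega⟩
  obtain ⟨C, hC⟩ := exists_coeff_mul_lazyWalk_pow_le (doubleGradient_mem a (-b))
  have hdist (x y : Site d) : 0 ≤ siteDist x y := Real.sqrt_nonneg _
  refine ⟨5 * C, fun n x y => le_trans ?_ (sum_range_sum_range_add_mul_pow_le hd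
    (fun _ => abs_nonneg _) (hdist x y) (fun m => (hC m x y).1) (fun m => (hC m x y).2) n)⟩
  exact mul_le_mul_of_nonneg_right (abs_coeff_greenGradient_mul_reflect_le ..)
    (pow_nonneg (hdist x y) _)

theorem exists_greenGradient_variance_le (hd : 3 ≤ d) (a : Site d) :
    ∃ K : ℝ, ∀ M N : ℕ,
      |(greenGradient a (Finset.Ico M N) * reflect (greenGradient a (Finset.Ico M N))).coeff 0| ≤
        K / √((M : ℝ) + 1) ^ (d - 2) := by
  have : NeZero d := ⟨by omega⟩
  obtain ⟨C, hC⟩ := exists_coeff_mul_lazyWalk_pow_le (doubleGradient_mem a (-a))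
  refine ⟨4 * C, fun M N => (abs_coeff_greenGradient_mul_reflect_le ..).trans
    ((sum_Ico_sum_Ico_add_le (F := fun m => |(doubleGradient a (-a) * lazyWalk d ^ m).coeff 0|)
      (fun _ => abs_nonneg _) M N).trans
    (sum_Ico_add_one_mul_le hd (fun _ => abs_nonneg _) (fun m => ?_) M _))⟩
  simpa using (hC m 0 0).1

end Green

section Disorder

open AddMonoidAlgebra

instance isProbabilityMeasure_disorderLaw (d : ℕ) (ν : Measure ℝ) [IsProbabilityMeasure ν] :
    IsProbabilityMeasure (disorderLaw d ν) := by
  unfold disorderLaw; infer_instance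

theorem measurable_shift {d : ℕ} (r : Site d) : Measurable (shift r) :=
  measurable_pi_lambda _ fun i => measurable_pi_apply (i - r)

/-- The action of the group algebra on fields: `f` acts on `u` by `x ↦ ∑ y, f y * u (x + y)`. -/
def act {G : Type*} [AddCommGroup G] : ℝ[G] →ₐ[ℝ] Module.End ℝ (G → ℝ) :=
  AddMonoidAlgebra.lift ℝ (Module.End ℝ (G → ℝ)) G
    { toFun := fun y => LinearMap.funLeft ℝ ℝ fun x => x + y.toAdd
      map_one' := by ext; simp [LinearMap.funLeft]
      map_mul' := fun y z => by
        ext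
        simp [LinearMap.funLeft, add_assoc] }

theorem act_single {G : Type*} [AddCommGroup G] (y : G) (r : ℝ) (u : G → ℝ) (x : G) :
    act (single y r) u x = r * u (x + y) := by
  simp [act, LinearMap.funLeft]

theorem act_eq_pairing {G : Type*} [AddCommGroup G] (f : ℝ[G]) (u : G → ℝ) (x : G) :
    act f u x = pairing (fun y => u (x + y)) f := by
  induction f using AddMonoidAlgebra.induction_linear with
  | zero => simp
  | add f g hf hg => simp [hf, hg]
  | single m r => simp [act_single]

variable {d : ℕ} {ν : Measure ℝ} [IsProbabilityMeasure ν]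

theorem measurePreserving_shift (r : Site d) :
    MeasurePreserving (shift r) (disorderLaw d ν) (disorderLaw d ν) := by
  refine ⟨measurable_shift r, ?_⟩
  have h := Measure.infinitePi_map_piCongrLeft (fun _ : Site d => ν) (Equiv.addRight r)
  have e : ⇑(MeasurableEquiv.piCongrLeft (fun _ : Site d => ℝ) (Equiv.addRight r)) =
      shift r := by
    funext η i
    simpa [shift] using MeasurableEquiv.piCongrLeft_apply_apply (β := fun _ : Site d => ℝ)
      (Equiv.addRight r) η (i - r)
  rwa [e] at h

theorem iIndepFun_coord :
    iIndepFun (fun (i : Site d) (η : Site d → ℝ) => η i) (disorderLaw d ν) :=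
  iIndepFun_infinitePi (P := fun _ : Site d => ν) (X := fun _ x => x) fun _ => measurable_id

theorem measurePreserving_coord (i : Site d) :
    MeasurePreserving (fun η : Site d → ℝ => η i) (disorderLaw d ν) ν :=
  measurePreserving_eval_infinitePi (fun _ : Site d => ν) i

theorem memLp_coord (hν : MemLp (fun x : ℝ => x) 2 ν) (i : Site d) :
    MemLp (fun η : Site d → ℝ => η i) 2 (disorderLaw d ν) :=
  hν.comp_measurePreserving (measurePreserving_coord i)

theorem covariance_coord (hν : MemLp (fun x : ℝ => x) 2 ν) (x y : Site d) :
    cov[fun η => η x, fun η => η y; disorderLaw d ν] =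
      if x = y then Var[fun t : ℝ => t; ν] else 0 := by
  split_ifs with h
  · rw [h, covariance_self (memLp_coord hν y).aemeasurable]
    exact (measurePreserving_coord y).variance_fun_comp hν.aemeasurable
  · exact (iIndepFun_coord.indepFun h).covariance_eq_zero (memLp_coord hν x) (memLp_coord hν y)

theorem memLp_act (hν : MemLp (fun x : ℝ => x) 2 ν) (f : ℝ[Site d]) (x : Site d) :
    MemLp (fun η => act f η x) 2 (disorderLaw d ν) := by
  simp only [act_eq_pairing, pairing_eq_sum]
  exact memLp_finsetSum _ fun y _ => (memLp_coord hν _).const_mul _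

theorem integral_act (hν : MemLp (fun x : ℝ => x) 2 ν) (f : ℝ[Site d]) (x : Site d) :
    ∫ η, act f η x ∂(disorderLaw d ν) = mass f * ∫ t, t ∂ν := by
  simp only [act_eq_pairing, pairing_eq_sum]
  rw [integral_finsetSum _ fun y _ => ((memLp_coord hν _).integrable one_le_two).const_mul _,
    mass_eq_sum, Finset.sum_mul]
  refine Finset.sum_congr rfl fun y _ => ?_
  rw [integral_const_mul, (measurePreserving_coord (x + y)).hasLaw.integral_eq]

theorem covariance_act (hν : MemLp (fun x : ℝ => x) 2 ν) (f g : ℝ[Site d]) (x y : Site d) :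
    cov[fun η => act f η x, fun η => act g η y; disorderLaw d ν] =
      Var[fun t : ℝ => t; ν] * (f * reflect g).coeff (y - x) := by
  induction f using AddMonoidAlgebra.induction_linear with
  | zero => simp
  | add f f' hf hf' =>
    have h : (fun η => act (f + f') η x) = (fun η => act f η x) + fun η => act f' η x := by
      simp only [map_add]; rfl
    rw [h, covariance_add_left (memLp_act hν f x) (memLp_act hν f' x) (memLp_act hν g y), hf, hf',
      add_mul, coeff_add, Finsupp.add_apply, mul_add]
  | single m r =>
    induction g using AddMonoidAlgebra.induction_linear with
    | zero => simp
    | add g g' hg hg' =>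
      have h : (fun η => act (g + g') η y) = (fun η => act g η y) + fun η => act g' η y := by
        simp only [map_add]; rfl
      rw [h, covariance_add_right (memLp_act hν _ x) (memLp_act hν g y) (memLp_act hν g' y), hg,
        hg', map_add, mul_add, coeff_add, Finsupp.add_apply, mul_add]
    | single m' r' =>
      have h : x + m = y + m' ↔ m + -m' = y - x := by
        rw [← sub_eq_add_neg, sub_eq_sub_iff_add_eq_add, add_comm x m]
      simp only [act_single, covariance_const_mul_left, covariance_const_mul_right,
        covariance_coord hν, reflect_single, single_mul_single, coeff_single,
        Finsupp.single_apply, h]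
      split_ifs <;> ring

theorem eLpNorm_two_eq_sqrt {Ω : Type*} [MeasurableSpace Ω] {P : Measure Ω} {f : Ω → ℝ}
    (hf : MemLp f 2 P) : eLpNorm f 2 P = ENNReal.ofReal (√(∫ ω, f ω ^ 2 ∂P)) := by
  rw [hf.eLpNorm_eq_integral_rpow_norm two_ne_zero ENNReal.ofNat_ne_top, Real.sqrt_eq_rpow]
  simp

end Disorder

section OrbitAverage

open AddMonoidAlgebra

variable {d : ℕ} {ν : Measure ℝ} [IsProbabilityMeasure ν]

/-- The average, with weights `f`, of a random variable along the orbit of the lattice shifts. -/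
def orbitAverage (f : ℝ[Site d]) (v : (Site d → ℝ) → ℝ) (η : Site d → ℝ) : ℝ :=
  pairing (fun y => v (shift (-y) η)) f

theorem orbitAverage_eq_sum (f : ℝ[Site d]) (v : (Site d → ℝ) → ℝ) :
    orbitAverage f v = ∑ y ∈ f.coeff.support, f.coeff y • (v ∘ shift (-y)) := by
  funext η
  simp [orbitAverage, pairing_eq_sum]

theorem orbitAverage_add (f : ℝ[Site d]) (v w : (Site d → ℝ) → ℝ) :
    orbitAverage f (v + w) = orbitAverage f v + orbitAverage f w := by
  funext η
  simp [orbitAverage_eq_sum, mul_add, Finset.sum_add_distrib]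

theorem orbitAverage_smul (f : ℝ[Site d]) (c : ℝ) (v : (Site d → ℝ) → ℝ) :
    orbitAverage f (c • v) = c • orbitAverage f v := by
  funext η
  simp [orbitAverage_eq_sum, Finset.mul_sum, mul_left_comm]

theorem aestronglyMeasurable_orbitAverage (f : ℝ[Site d]) {v : (Site d → ℝ) → ℝ}
    (hv : AEStronglyMeasurable v (disorderLaw d ν)) :
    AEStronglyMeasurable (orbitAverage f v) (disorderLaw d ν) := by
  rw [orbitAverage_eq_sum]
  exact Finset.aestronglyMeasurable_sum _ fun y _ =>
    (hv.comp_measurePreserving (measurePreserving_shift (-y))).const_smul _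

theorem memLp_orbitAverage (f : ℝ[Site d]) {v : (Site d → ℝ) → ℝ} {p : ℝ≥0∞}
    (hv : MemLp v p (disorderLaw d ν)) : MemLp (orbitAverage f v) p (disorderLaw d ν) := by
  rw [orbitAverage_eq_sum]
  exact memLp_finsetSum' _ fun y _ =>
    (hv.comp_measurePreserving (measurePreserving_shift (-y))).const_smul _

theorem integral_orbitAverage (f : ℝ[Site d]) {v : (Site d → ℝ) → ℝ}
    (hv : Integrable v (disorderLaw d ν)) :
    ∫ η, orbitAverage f v η ∂(disorderLaw d ν) = mass f * ∫ η, v η ∂(disorderLaw d ν) := by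
  have hi (y : Site d) : Integrable (fun η => v (shift (-y) η)) (disorderLaw d ν) :=
    (measurePreserving_shift (-y)).integrable_comp_of_integrable hv
  simp only [orbitAverage, pairing_eq_sum]
  rw [integral_finsetSum _ fun y _ => (hi y).const_mul _, mass_eq_sum, Finset.sum_mul]
  refine Finset.sum_congr rfl fun y _ => ?_
  rw [integral_const_mul]
  exact congrArg _ ((measurePreserving_shift (-y)).hasLaw.integral_comp hv.1)

theorem eLpNorm_orbitAverage_le (f : ℝ[Site d]) {v : (Site d → ℝ) → ℝ}
    (hv : AEStronglyMeasurable v (disorderLaw d ν)) :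
    eLpNorm (orbitAverage f v) 1 (disorderLaw d ν) ≤
      ENNReal.ofReal (l1 f) * eLpNorm v 1 (disorderLaw d ν) := by
  rw [orbitAverage_eq_sum, l1, ENNReal.ofReal_sum_of_nonneg fun _ _ => abs_nonneg _,
    Finset.sum_mul]
  refine (eLpNorm_sum_le (fun y _ => ?_) le_rfl).trans (Finset.sum_le_sum fun y _ => ?_)
  · exact (hv.comp_measurePreserving (measurePreserving_shift (-y))).const_smul _
  · rw [eLpNorm_const_smul, eLpNorm_comp_measurePreserving hv (measurePreserving_shift (-y)),
      Real.enorm_eq_ofReal_abs]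

theorem abs_covariance_le {Ω : Type*} [MeasurableSpace Ω] {P : Measure Ω} [IsFiniteMeasure P]
    {X Y : Ω → ℝ} (hX : MemLp X 2 P) (hY : MemLp Y 2 P) :
    |cov[X, Y; P]| ≤ (Var[X; P] + Var[Y; P]) / 2 := by
  have hadd := variance_add hX hY
  have hsub := variance_sub hX hY
  have := variance_nonneg (X + Y) P
  have := variance_nonneg (X - Y) P
  rw [abs_le]
  constructor <;> linarith

/-- The random variable `v` depends on the disorder at the sites of `Λ` only. -/
def IsLocal (Λ : Finset (Site d)) (v : (Site d → ℝ) → ℝ) : Prop :=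
  ∃ g : (Λ → ℝ) → ℝ, Measurable g ∧ v = g ∘ Λ.restrict

theorem IsLocal.covariance_shift_eq_zero {Λ : Finset (Site d)} {v : (Site d → ℝ) → ℝ}
    (hloc : IsLocal Λ v) (hv : MemLp v 2 (disorderLaw d ν)) {y z : Site d}
    (hyz : ∀ i ∈ Λ, ∀ j ∈ Λ, i - j ≠ z - y) :
    cov[v ∘ shift (-y), v ∘ shift (-z); disorderLaw d ν] = 0 := by
  classical
  obtain ⟨g, hg, rfl⟩ := hloc
  have hdisj : Disjoint (Λ.image (· + y)) (Λ.image (· + z)) := by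
    rw [Finset.disjoint_left]
    rintro x hx hx'
    obtain ⟨i, hi, rfl⟩ := Finset.mem_image.1 hx
    obtain ⟨j, hj, hij⟩ := Finset.mem_image.1 hx'
    refine hyz i hi j hj ?_
    rw [sub_eq_sub_iff_add_eq_add, ← hij, add_comm]
  let translate (y : Site d) (x : (Λ.image (· + y) : Finset (Site d)) → ℝ) (i : Λ) : ℝ :=
    x ⟨i + y, Finset.mem_image_of_mem _ i.2⟩
  have hm (y : Site d) : Measurable (g ∘ translate y) :=
    hg.comp (measurable_pi_lambda _ fun i => measurable_pi_apply _)
  have hrep (y : Site d) : (g ∘ Λ.restrict) ∘ shift (-y) =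
      (g ∘ translate y) ∘ (Λ.image (· + y)).restrict := by
    funext η
    simp only [Function.comp_apply]
    congr 1
    funext i
    simp [shift, translate]
  have hind : IndepFun ((g ∘ Λ.restrict) ∘ shift (-y)) ((g ∘ Λ.restrict) ∘ shift (-z))
      (disorderLaw d ν) := by
    rw [hrep y, hrep z]
    exact (iIndepFun_coord.indepFun_finset _ _ hdisj fun i => measurable_pi_apply i).comp
      (hm y) (hm z)
  exact hind.covariance_eq_zero (hv.comp_measurePreserving (measurePreserving_shift _))
    (hv.comp_measurePreserving (measurePreserving_shift _))

theorem IsLocal.abs_covariance_shift_le {Λ D : Finset (Site d)} {v : (Site d → ℝ) → ℝ}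
    (hloc : IsLocal Λ v) (hv : MemLp v 2 (disorderLaw d ν)) (hD : ∀ i ∈ Λ, ∀ j ∈ Λ, i - j ∈ D)
    (y z : Site d) :
    |cov[v ∘ shift (-y), v ∘ shift (-z); disorderLaw d ν]| ≤
      if z - y ∈ D then Var[v; disorderLaw d ν] else 0 := by
  have hL (y : Site d) : MemLp (v ∘ shift y) 2 (disorderLaw d ν) :=
    hv.comp_measurePreserving (measurePreserving_shift y)
  have hvar (y : Site d) : Var[v ∘ shift y; disorderLaw d ν] = Var[v; disorderLaw d ν] :=
    (measurePreserving_shift y).variance_fun_comp hv.aemeasurable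
  split_ifs with h
  · refine (abs_covariance_le (hL _) (hL _)).trans_eq ?_
    rw [hvar, hvar, add_self_div_two]
  · rw [hloc.covariance_shift_eq_zero hv fun i hi j hj hij => h (hij ▸ hD i hi j hj), abs_zero]

/-- Only the pairs `y, z` with `z - y` in a fixed finite set contribute to the variance, so
spreading the weights makes it small. -/
theorem IsLocal.exists_variance_orbitAverage_le {Λ : Finset (Site d)} {v : (Site d → ℝ) → ℝ}
    (hloc : IsLocal Λ v) (hv : MemLp v 2 (disorderLaw d ν)) :
    ∃ K : ℝ, ∀ (f : ℝ[Site d]) (s : ℝ), 0 ≤ f.coeff → mass f = 1 → (∀ z, f.coeff z ≤ s) →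
      Var[orbitAverage f v; disorderLaw d ν] ≤ K * s := by
  classical
  set D := Finset.image₂ (fun i j => i - j) Λ Λ
  refine ⟨D.card * Var[v; disorderLaw d ν], fun f s hf hmass hs => ?_⟩
  have hL (y : Site d) : MemLp (f.coeff y • (v ∘ shift (-y))) 2 (disorderLaw d ν) :=
    (hv.comp_measurePreserving (measurePreserving_shift (-y))).const_smul _
  set S := f.coeff.support
  set c := f.coeff
  set σ := Var[v; disorderLaw d ν]
  have hσ : 0 ≤ σ := variance_nonneg _ _
  have hnear (y : Site d) : ∑ z ∈ S with z - y ∈ D, c z ≤ D.card * s := by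
    have hsub : S.filter (fun z => z - y ∈ D) ⊆ D.image (· + y) := fun z hz =>
      Finset.mem_image.2 ⟨z - y, (Finset.mem_filter.1 hz).2, sub_add_cancel z y⟩
    calc ∑ z ∈ S with z - y ∈ D, c z ≤ ∑ z ∈ D.image (· + y), c z :=
          Finset.sum_le_sum_of_subset_of_nonneg hsub fun z _ _ => hf z
      _ ≤ (D.image (· + y)).card * s := by
          rw [← nsmul_eq_mul]; exact Finset.sum_le_card_nsmul _ _ _ fun z _ => hs z
      _ ≤ D.card * s := mul_le_mul_of_nonneg_right (by exact_mod_cast Finset.card_image_le)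
          ((hf 0).trans (hs 0))
  calc Var[orbitAverage f v; disorderLaw d ν]
      = ∑ y ∈ S, ∑ z ∈ S, c y * (c z * cov[v ∘ shift (-y), v ∘ shift (-z); disorderLaw d ν]) := by
        rw [← covariance_self (memLp_orbitAverage f hv).aemeasurable, orbitAverage_eq_sum,
          covariance_sum_sum' (fun y _ => hL y) (fun z _ => hL z)]
        simp_rw [covariance_smul_left, covariance_smul_right, S]
    _ ≤ ∑ y ∈ S, ∑ z ∈ S, c y * (c z * if z - y ∈ D then σ else 0) :=
        Finset.sum_le_sum fun y _ => Finset.sum_le_sum fun z _ =>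
          mul_le_mul_of_nonneg_left (mul_le_mul_of_nonneg_left ((le_abs_self _).trans
            (hloc.abs_covariance_shift_le hv
              (fun i hi j hj => Finset.mem_image₂_of_mem hi hj) y z)) (hf z)) (hf y)
    _ = ∑ y ∈ S, c y * (σ * ∑ z ∈ S with z - y ∈ D, c z) := by
        refine Finset.sum_congr rfl fun y _ => ?_
        simp only [Finset.sum_filter, mul_ite, mul_zero, mul_comm σ, Finset.sum_mul, ite_mul,
          zero_mul, Finset.mul_sum]
    _ ≤ ∑ y ∈ S, c y * (σ * (D.card * s)) :=
        Finset.sum_le_sum fun y _ => mul_le_mul_of_nonneg_left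
          (mul_le_mul_of_nonneg_left (hnear y) hσ) (hf y)
    _ = D.card * σ * s := by
        rw [← Finset.sum_mul, ← mass_eq_sum, hmass]; ring

end OrbitAverage

section MeanErgodic

open AddMonoidAlgebra

variable {d : ℕ} {ν : Measure ℝ} [IsProbabilityMeasure ν]

variable (ν) in
/-- The `L¹` distance between the orbit average of `v` with weights `f` and the mean of `v`. -/
def ergodicError (f : ℝ[Site d]) (v : (Site d → ℝ) → ℝ) : ℝ≥0∞ :=
  eLpNorm (orbitAverage f v - fun _ => ∫ η, v η ∂(disorderLaw d ν)) 1 (disorderLaw d ν)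

theorem ergodicError_add_le (f : ℝ[Site d]) {v w : (Site d → ℝ) → ℝ}
    (hv : Integrable v (disorderLaw d ν)) (hw : Integrable w (disorderLaw d ν)) :
    ergodicError ν f (v + w) ≤ ergodicError ν f v + ergodicError ν f w := by
  have e : orbitAverage f (v + w) - (fun _ => ∫ η, (v + w) η ∂(disorderLaw d ν)) =
      (orbitAverage f v - fun _ => ∫ η, v η ∂(disorderLaw d ν)) +
        (orbitAverage f w - fun _ => ∫ η, w η ∂(disorderLaw d ν)) := by
    simp only [orbitAverage_add, Pi.add_apply, integral_add hv hw]
    exact add_sub_add_comm ..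
  rw [ergodicError, e]
  exact eLpNorm_add_le ((aestronglyMeasurable_orbitAverage _ hv.1).sub aestronglyMeasurable_const)
    ((aestronglyMeasurable_orbitAverage _ hw.1).sub aestronglyMeasurable_const) le_rfl

theorem ergodicError_smul (f : ℝ[Site d]) (c : ℝ) (v : (Site d → ℝ) → ℝ) :
    ergodicError ν f (c • v) = ‖c‖ₑ * ergodicError ν f v := by
  rw [ergodicError, ergodicError, ← eLpNorm_const_smul, orbitAverage_smul, smul_sub]
  simp only [Pi.smul_apply, integral_smul]
  rfl

theorem ergodicError_le (f : ℝ[Site d]) {v : (Site d → ℝ) → ℝ}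
    (hv : Integrable v (disorderLaw d ν)) :
    ergodicError ν f v ≤ (ENNReal.ofReal (l1 f) + 1) * eLpNorm v 1 (disorderLaw d ν) := by
  rw [add_mul, one_mul]
  refine (eLpNorm_sub_le (aestronglyMeasurable_orbitAverage f hv.1) aestronglyMeasurable_const
    le_rfl).trans (add_le_add (eLpNorm_orbitAverage_le f hv.1) ?_)
  rw [eLpNorm_const _ one_ne_zero (IsProbabilityMeasure.ne_zero _), measure_univ,
    ENNReal.one_rpow, mul_one, eLpNorm_one_eq_lintegral_enorm]
  exact enorm_integral_le_lintegral_enorm _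

theorem ergodicError_le_sqrt_variance {f : ℝ[Site d]} (hf : mass f = 1)
    {v : (Site d → ℝ) → ℝ} (hv : MemLp v 2 (disorderLaw d ν)) :
    ergodicError ν f v ≤ ENNReal.ofReal √(Var[orbitAverage f v; disorderLaw d ν]) := by
  have hm := (memLp_orbitAverage f hv).sub (memLp_const (∫ η, v η ∂(disorderLaw d ν)))
  refine (eLpNorm_le_eLpNorm_of_exponent_le one_le_two hm.1).trans_eq ?_
  rw [eLpNorm_two_eq_sqrt hm, variance_eq_integral (memLp_orbitAverage f hv).aemeasurable,
    integral_orbitAverage f (hv.integrable one_le_two), hf, one_mul]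
  rfl

variable (ν) in
/-- The averages of `v` along the lazy walk converge in `L¹` to its mean. -/
def ErgodicAlongWalk (v : (Site d → ℝ) → ℝ) : Prop :=
  Tendsto (fun n : ℕ => ergodicError ν (lazyWalk d ^ n) v) atTop (nhds 0)

theorem ErgodicAlongWalk.add {v w : (Site d → ℝ) → ℝ} (hv : Integrable v (disorderLaw d ν))
    (hw : Integrable w (disorderLaw d ν)) (h : ErgodicAlongWalk ν v)
    (h' : ErgodicAlongWalk ν w) : ErgodicAlongWalk ν (v + w) := by
  have hlim := Tendsto.add h h'
  rw [add_zero] at hlim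
  exact tendsto_of_tendsto_of_tendsto_of_le_of_le tendsto_const_nhds hlim (fun _ => zero_le)
    fun n => ergodicError_add_le _ hv hw

theorem ErgodicAlongWalk.smul {v : (Site d → ℝ) → ℝ} (h : ErgodicAlongWalk ν v) (c : ℝ) :
    ErgodicAlongWalk ν (c • v) := by
  have hlim := ENNReal.Tendsto.const_mul (a := ‖c‖ₑ) h (Or.inr enorm_ne_top)
  rw [mul_zero] at hlim
  simpa only [ErgodicAlongWalk, ergodicError_smul] using hlim

theorem ergodicAlongWalk_of_approx [NeZero d] {v : (Site d → ℝ) → ℝ}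
    (hv : Integrable v (disorderLaw d ν))
    (h : ∀ ε : ℝ≥0∞, 0 < ε → ∃ w, Integrable w (disorderLaw d ν) ∧ ErgodicAlongWalk ν w ∧
      eLpNorm (v - w) 1 (disorderLaw d ν) ≤ ε) : ErgodicAlongWalk ν v := by
  refine ENNReal.tendsto_nhds_zero.2 fun ε hε => ?_
  have hε3 : 0 < ε / 3 := ENNReal.div_pos hε.ne' (by norm_num)
  obtain ⟨w, hw, herg, hvw⟩ := h _ hε3
  filter_upwards [ENNReal.tendsto_nhds_zero.1 herg _ hε3] with n hn
  calc ergodicError ν (lazyWalk d ^ n) v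
      = ergodicError ν (lazyWalk d ^ n) ((v - w) + w) := by rw [sub_add_cancel]
    _ ≤ ergodicError ν (lazyWalk d ^ n) (v - w) + ergodicError ν (lazyWalk d ^ n) w :=
        ergodicError_add_le _ (hv.sub hw) hw
    _ ≤ (1 + 1) * (ε / 3) + ε / 3 := by
        refine add_le_add ((ergodicError_le _ (hv.sub hw)).trans ?_) hn
        rw [isLazyStep_lazyWalk.l1_pow, ENNReal.ofReal_one]
        exact mul_le_mul_right hvw _
    _ = ε := by rw [one_add_one_eq_two, two_mul, ENNReal.add_thirds]

theorem IsLocal.ergodicAlongWalk [NeZero d] {Λ : Finset (Site d)} {v : (Site d → ℝ) → ℝ}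
    (hloc : IsLocal Λ v) (hv : MemLp v 2 (disorderLaw d ν)) : ErgodicAlongWalk ν v := by
  obtain ⟨K, hK⟩ := hloc.exists_variance_orbitAverage_le hv
  obtain ⟨C, hC⟩ := exists_coeff_mul_lazyWalk_pow_le (d := d) (k := 0) (f := 1) (by simp)
  have hlim : Tendsto (fun n : ℕ => ENNReal.ofReal √(K * (C / √((n : ℝ) + 1) ^ d)))
      atTop (nhds 0) := by
    have hdiv : Tendsto (fun n : ℕ => C / √((n : ℝ) + 1) ^ d) atTop (nhds 0) :=
      Tendsto.div_atTop tendsto_const_nhds ((tendsto_pow_atTop (NeZero.ne d)).comp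
        (Real.tendsto_sqrt_atTop.comp
          (tendsto_atTop_add_const_right _ _ tendsto_natCast_atTop_atTop)))
    simpa using ENNReal.tendsto_ofReal (Real.continuous_sqrt.tendsto _ |>.comp (hdiv.const_mul K))
  refine tendsto_of_tendsto_of_tendsto_of_le_of_le tendsto_const_nhds hlim
    (fun _ => zero_le) fun n => ?_
  have hmass : mass (lazyWalk d ^ n) = 1 := by
    rw [map_pow, isLazyStep_lazyWalk.mass_eq_one, one_pow]
  refine (ergodicError_le_sqrt_variance hmass hv).trans
    (ENNReal.ofReal_le_ofReal (Real.sqrt_le_sqrt ?_))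
  refine hK _ _ (coeff_pow_nonneg isLazyStep_lazyWalk.nonneg n) hmass fun z => ?_
  simpa using (le_abs_self _).trans (hC n 0 z).1

theorem ergodicAlongWalk_indicator [NeZero d] {A : Set (Site d → ℝ)} (hA : MeasurableSet A) :
    ErgodicAlongWalk ν (A.indicator fun _ => 1) := by
  have hdense := Measure.MeasureDense.of_generateFrom_isSetAlgebra_finite (disorderLaw d ν)
    isSetAlgebra_measurableCylinders
    (generateFrom_measurableCylinders (α := fun _ : Site d => ℝ)).symm
  refine ergodicAlongWalk_of_approx ((integrable_const _).indicator hA) fun ε hε => ?_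
  obtain ⟨δ, hδ0, hδ⟩ : ∃ δ : ℝ, 0 < δ ∧ ENNReal.ofReal δ ≤ ε := by
    obtain rfl | hε' := eq_or_ne ε ⊤
    · exact ⟨1, one_pos, le_top⟩
    · exact ⟨ε.toReal, ENNReal.toReal_pos hε.ne' hε', ENNReal.ofReal_toReal_le⟩
  obtain ⟨B, hB, hAB⟩ := hdense.approx A hA (measure_ne_top _ _) δ hδ0
  have hBm := hdense.measurable B hB
  have hloc : ∃ Λ, IsLocal Λ (B.indicator fun _ => (1 : ℝ)) := by
    obtain ⟨Λ, S, hS, rfl⟩ := (mem_measurableCylinders _).1 hB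
    exact ⟨Λ, S.indicator fun _ => 1, measurable_const.indicator hS, rfl⟩
  obtain ⟨Λ, hΛ⟩ := hloc
  refine ⟨_, (integrable_const (1 : ℝ)).indicator hBm,
    hΛ.ergodicAlongWalk ((memLp_const 1).indicator hBm), ?_⟩
  rw [eLpNorm_indicator_sub_indicator, eLpNorm_indicator_const (hA.symmDiff hBm) one_ne_zero
    ENNReal.one_ne_top]
  simpa using hAB.le.trans hδ

theorem ergodicAlongWalk_of_integrable [NeZero d] {v : (Site d → ℝ) → ℝ}
    (hv : Integrable v (disorderLaw d ν)) : ErgodicAlongWalk ν v := by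
  refine Integrable.induction (ErgodicAlongWalk ν) ?_ ?_ ?_ ?_ hv
  · intro c A hA _
    have e : (A.indicator fun _ => c) = c • A.indicator fun _ => (1 : ℝ) := by
      funext η
      by_cases hη : η ∈ A <;> simp [hη]
    rw [e]
    exact (ergodicAlongWalk_indicator hA).smul c
  · intro f g _ hf hg hf' hg'
    exact hf'.add hf hg hg'
  · refine isClosed_of_closure_subset fun f hf => ?_
    refine ergodicAlongWalk_of_approx (L1.integrable_coeFn f) fun ε hε => ?_
    obtain ⟨g, hg, hfg⟩ := EMetric.mem_closure_iff.1 hf ε hε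
    rw [Lp.edist_def] at hfg
    exact ⟨g, L1.integrable_coeFn g, hg, hfg.le⟩
  · intro f g hfg hf h
    refine ergodicAlongWalk_of_approx (hf.congr hfg) fun ε _ => ⟨f, hf, h, ?_⟩
    rw [eLpNorm_congr_ae (hfg.symm.sub (EventuallyEq.refl _ f)), sub_self, eLpNorm_zero]
    exact zero_le

end MeanErgodic

section SingleSite

variable {d : ℕ}

theorem nnKernel_eq (y : Site d) :
    nnKernel d y = if y ∈ neighbors d then 1 / (2 * (d : ℝ)) else 0 := by
  simp only [nnKernel, mem_neighbors]

theorem natCast_pos_of_mem_neighbors {y : Site d} (hy : y ∈ neighbors d) : 0 < (d : ℝ) := by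
  have h : 0 < (neighbors d).card := Finset.card_pos.2 ⟨y, hy⟩
  rw [card_neighbors] at h
  exact_mod_cast (by lia : 0 < d)

theorem nnKernel_pos_iff {y : Site d} : 0 < nnKernel d y ↔ y ∈ neighbors d := by
  rw [nnKernel_eq]
  split_ifs with h
  · have := natCast_pos_of_mem_neighbors h
    exact iff_of_true (by positivity) h
  · exact iff_of_false (lt_irrefl 0) h

/-- The edge from `i` to its neighbour `i + y`. -/
def edgeTo (i : Site d) (y : neighbors d) : Edge (nnKernel d) :=
  ⟨(i, i + y), by
    rw [nnKernel_pos_iff, sub_add_cancel_left]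
    exact neg_mem_neighbors.2 y.2⟩

/-- The average of `φ` over the nearest neighbours of the site `i`. -/
def neighborMean (φ : Site d → ℝ) (i : Site d) : ℝ :=
  ∑ y ∈ neighbors d, 1 / (2 * (d : ℝ)) * φ (i + y)

theorem sum_neighbors_const [NeZero d] : ∑ _y ∈ neighbors d, 1 / (2 * (d : ℝ)) = 1 := by
  have : (d : ℝ) ≠ 0 := NeZero.ne _
  rw [Finset.sum_const, card_neighbors, nsmul_eq_mul]
  push_cast
  field_simp

theorem sub_neighborMean [NeZero d] (φ : Site d → ℝ) (i : Site d) :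
    φ i - neighborMean φ i = neighborMean (fun j => φ i - φ j) i := by
  simp only [neighborMean, mul_sub, Finset.sum_sub_distrib]
  rw [← Finset.sum_mul, sum_neighbors_const, one_mul]

theorem neighborMean_congr {φ ψ : Site d → ℝ} {i : Site d} (h : ∀ j ≠ i, φ j = ψ j) :
    neighborMean φ i = neighborMean ψ i := by
  refine Finset.sum_congr rfl fun y hy => ?_
  rw [h]
  simpa using fun h0 : y = 0 => zero_notMem_neighbors (h0 ▸ hy)

/-- The divergence of a gradient configuration at the site `i`. -/
def divergence (i : Site d) (u : GradConf (nnKernel d)) : ℝ :=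
  ∑ y : neighbors d, 1 / (2 * (d : ℝ)) * u.1 (edgeTo i y)

theorem measurable_gradConf_apply {p : Site d → ℝ} (e : Edge p) :
    Measurable fun u : GradConf p => u.1 e :=
  (measurable_pi_apply e).comp measurable_subtype_coe

theorem measurable_divergence (i : Site d) : Measurable (divergence i) :=
  Finset.measurable_sum _ fun y _ => (measurable_gradConf_apply (edgeTo i y)).const_mul _

theorem divergence_toGradConf [NeZero d] (i : Site d) (φ : Site d → ℝ) :
    divergence i (toGradConf _ φ) = φ i - neighborMean φ i := by
  have h : divergence i (toGradConf _ φ) =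
      ∑ y ∈ neighbors d, 1 / (2 * (d : ℝ)) * (φ i - φ (i + y)) :=
    Finset.sum_coe_sort (neighbors d) fun y => 1 / (2 * (d : ℝ)) * (φ i - φ (i + y))
  rw [h, sub_neighborMean]
  rfl

theorem measurable_toGradConf (p : Site d → ℝ) : Measurable (toGradConf p) :=
  Measurable.subtype_mk (measurable_pi_lambda _ fun e =>
    (measurable_pi_apply e.1.1).sub (measurable_pi_apply e.1.2))

theorem measurable_glue (Λ : Finset (Site d)) (b : Site d → ℝ) : Measurable (glue Λ b) := by
  refine measurable_pi_lambda _ fun i => ?_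
  by_cases h : i ∈ Λ
  · simpa [glue, h] using measurable_pi_apply (⟨i, h⟩ : Λ)
  · simp [glue, h]

theorem glue_singleton_self (i : Site d) (b : Site d → ℝ) (x : ({i} : Finset (Site d)) → ℝ) :
    glue {i} b x i = x default := by
  simp only [glue, Finset.mem_singleton, dif_pos]
  congr

theorem glue_singleton_of_ne {i j : Site d} (h : j ≠ i) (b : Site d → ℝ)
    (x : ({i} : Finset (Site d)) → ℝ) : glue {i} b x j = b j := by
  simp [glue, h]

theorem divergence_glue_singleton [NeZero d] (i : Site d) (b : Site d → ℝ)
    (x : ({i} : Finset (Site d)) → ℝ) :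
    divergence i (toGradConf _ (glue {i} b x)) = x default - neighborMean b i := by
  rw [divergence_toGradConf, glue_singleton_self,
    neighborMean_congr fun j hj => glue_singleton_of_ne hj b x]

theorem tsum_nnKernel_sub_mul (i : Site d) (F : Site d → ℝ) :
    ∑' j : {j : Site d // j ∉ ({i} : Finset (Site d))}, nnKernel d (i - j) * F j =
      neighborMean F i := by
  have h0 : ∀ y ∈ neighbors d, y ≠ 0 := fun y hy h => zero_notMem_neighbors (h ▸ hy)
  refine (tsum_subtype {j | j ∉ ({i} : Finset (Site d))} fun j => nnKernel d (i - j) * F j).trans ?_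
  rw [← (Equiv.addLeft i).tsum_eq, tsum_eq_sum (s := neighbors d)]
  · refine Finset.sum_congr rfl fun y hy => ?_
    rw [Set.indicator_of_mem (by simpa using h0 y hy), Equiv.coe_addLeft, sub_add_cancel_left,
      nnKernel_eq, if_pos (neg_mem_neighbors.2 hy)]
  · intro y hy
    refine Set.indicator_apply_eq_zero.2 fun _ => ?_
    rw [Equiv.coe_addLeft, sub_add_cancel_left, nnKernel_eq, if_neg (mt neg_mem_neighbors.1 hy),
      zero_mul]

theorem energy_singleton (i : Site d) (η φ : Site d → ℝ) :
    energy (nnKernel d) gaussianPotential {i} η φ =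
      neighborMean (fun j => (φ i - φ j) ^ 2 / 2) i - η i * φ i := by
  have h0 : nnKernel d (i - i) = 0 := by
    rw [sub_self, nnKernel_eq, if_neg zero_notMem_neighbors]
  simp only [energy, Finset.sum_singleton, h0, zero_mul, mul_zero, zero_add]
  rw [tsum_nnKernel_sub_mul i fun j => gaussianPotential (φ i - φ j)]
  rfl

theorem neighborMean_half_sq [NeZero d] (t : ℝ) (b : Site d → ℝ) (i : Site d) :
    neighborMean (fun j => (t - b j) ^ 2 / 2) i =
      t ^ 2 / 2 - t * neighborMean b i + neighborMean (fun j => b j ^ 2 / 2) i := by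
  have h : ∀ y ∈ neighbors d, 1 / (2 * (d : ℝ)) * ((t - b (i + y)) ^ 2 / 2) =
      1 / (2 * (d : ℝ)) * (t ^ 2 / 2) - t * (1 / (2 * (d : ℝ)) * b (i + y)) +
        1 / (2 * (d : ℝ)) * (b (i + y) ^ 2 / 2) := fun y _ => by ring
  simp only [neighborMean]
  rw [Finset.sum_congr rfl h, Finset.sum_add_distrib, Finset.sum_sub_distrib, ← Finset.sum_mul,
    ← Finset.mul_sum _ _ t, sum_neighbors_const, one_mul]

theorem energy_glue_singleton [NeZero d] (i : Site d) (η b : Site d → ℝ)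
    (x : ({i} : Finset (Site d)) → ℝ) :
    energy (nnKernel d) gaussianPotential {i} η (glue {i} b x) =
      (x default - (η i + neighborMean b i)) ^ 2 / 2 -
        ((η i + neighborMean b i) ^ 2 / 2 - neighborMean (fun j => b j ^ 2 / 2) i) := by
  have h : neighborMean (fun j => (x default - glue {i} b x j) ^ 2 / 2) i =
      neighborMean (fun j => (x default - b j) ^ 2 / 2) i :=
    neighborMean_congr fun j hj => by rw [glue_singleton_of_ne hj]
  rw [energy_singleton, glue_singleton_self, h, neighborMean_half_sq]
  ring

theorem exists_ofReal_exp_eq_mul_gaussianPDF (m c : ℝ) :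
    ∃ K : ℝ≥0∞, K ≠ 0 ∧ K ≠ ⊤ ∧ ∀ t : ℝ,
      ENNReal.ofReal (Real.exp (-((t - m) ^ 2 / 2 - c))) = K * gaussianPDF m 1 t := by
  refine ⟨ENNReal.ofReal (√(2 * Real.pi) * Real.exp c), (ENNReal.ofReal_pos.2 (by positivity)).ne',
    ENNReal.ofReal_ne_top, fun t => ?_⟩
  rw [gaussianPDF, gaussianPDFReal, ← ENNReal.ofReal_mul (by positivity),
    show -((t - m) ^ 2 / 2 - c) = c + -(t - m) ^ 2 / 2 by ring, Real.exp_add]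
  simp only [NNReal.coe_one, mul_one]
  field_simp

theorem map_withDensity_comp {α β : Type*} [MeasurableSpace α] [MeasurableSpace β] {ρ : Measure α}
    {σ : Measure β} {g : α → β} (hg : MeasurePreserving g ρ σ) {f : β → ℝ≥0∞} (hf : Measurable f) :
    (ρ.withDensity (f ∘ g)).map g = σ.withDensity f := by
  ext B hB
  rw [Measure.map_apply hg.measurable hB, withDensity_apply _ (hg.measurable hB),
    withDensity_apply _ hB]
  exact hg.setLIntegral_comp_preimage hB hf

theorem exists_map_withDensity_weight_singleton [NeZero d] (i : Site d) (η b : Site d → ℝ) :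
    ∃ K : ℝ≥0∞, K ≠ 0 ∧ K ≠ ⊤ ∧
      (volume.withDensity (weight (nnKernel d) gaussianPotential {i} η b)).map
        (fun x => x default) = K • gaussianReal (η i + neighborMean b i) 1 := by
  obtain ⟨K, hK0, hKt, hK⟩ := exists_ofReal_exp_eq_mul_gaussianPDF (η i + neighborMean b i)
    ((η i + neighborMean b i) ^ 2 / 2 - neighborMean (fun j => b j ^ 2 / 2) i)
  refine ⟨K, hK0, hKt, ?_⟩
  have hw : weight (nnKernel d) gaussianPotential {i} η b =
      (K • gaussianPDF (η i + neighborMean b i) 1) ∘ fun x => x default := by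
    funext x
    rw [weight, energy_glue_singleton, hK]
    rfl
  rw [hw, gaussianReal_of_var_ne_zero _ one_ne_zero, ← withDensity_smul K (by fun_prop)]
  exact map_withDensity_comp (volume_preserving_funUnique ({i} : Finset (Site d)) ℝ) (by fun_prop)

theorem map_divergence_finiteGradGibbs [NeZero d] (i : Site d) (η : Site d → ℝ)
    (u : GradConf (nnKernel d)) :
    (finiteGradGibbs (nnKernel d) gaussianPotential {i} η u).map (divergence i) =
      gaussianReal (η i) 1 := by
  set b := potential u
  set ρ := volume.withDensity (weight (nnKernel d) gaussianPotential {i} η b) with hρ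
  obtain ⟨K, hK0, hKt, hK⟩ := exists_map_withDensity_weight_singleton i η b
  have hev : Measurable fun x : ({i} : Finset (Site d)) → ℝ => x default := measurable_pi_apply _
  have hZ : ∫⁻ x, weight (nnKernel d) gaussianPotential {i} η b x = K := by
    rw [← setLIntegral_univ, ← withDensity_apply _ MeasurableSet.univ, ← hρ, ← Set.preimage_univ,
      ← Measure.map_apply hev MeasurableSet.univ, hK]
    simp
  have hdiv : divergence i ∘ toGradConf (nnKernel d) ∘ glue {i} b =
      (fun t => t - neighborMean b i) ∘ fun x => x default :=
    funext fun x => divergence_glue_singleton i b x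
  have hmap : ((ρ.map (glue {i} b)).map (toGradConf (nnKernel d))).map (divergence i) =
      K • gaussianReal (η i) 1 := by
    rw [Measure.map_map (measurable_toGradConf _) (measurable_glue _ _),
      Measure.map_map (measurable_divergence i)
        ((measurable_toGradConf _).comp (measurable_glue _ _)), hdiv,
      ← Measure.map_map (by fun_prop) hev, hK, Measure.map_smul, gaussianReal_map_sub_const,
      add_sub_cancel_right]
  rw [finiteGradGibbs, finiteGibbs, Measure.map_smul, Measure.map_smul, hmap, hZ, smul_smul,
    ENNReal.inv_mul_cancel hK0 hKt, one_smul]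

theorem IsGradientGibbs.map_divergence [NeZero d] {η : Site d → ℝ}
    {μ : Measure (GradConf (nnKernel d))} [IsProbabilityMeasure μ]
    (h : IsGradientGibbs (nnKernel d) gaussianPotential η μ) (i : Site d) :
    μ.map (divergence i) = gaussianReal (η i) 1 := by
  ext A hA
  have hu : ∀ u, finiteGradGibbs (nnKernel d) gaussianPotential {i} η u (divergence i ⁻¹' A) =
      gaussianReal (η i) 1 A := fun u => by
    rw [← Measure.map_apply (measurable_divergence i) hA, map_divergence_finiteGradGibbs]
  rw [Measure.map_apply (measurable_divergence i) hA, ← h {i} _ (measurable_divergence i hA)]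
  simp [hu]

end SingleSite

section MeanGradient

open AddMonoidAlgebra

variable {d : ℕ} {η : Site d → ℝ} {μ : Measure (GradConf (nnKernel d))}

theorem grad_potential {p : Site d → ℝ} (u : GradConf p) (e : Edge p) :
    potential u e.1.1 - potential u e.1.2 = u.1 e :=
  congrFun (Classical.choose_spec (exists_potential u)).2 e

/-- The mean of the height difference `φ x - φ y` under a measure on gradient configurations. -/
def meanDiff {p : Site d → ℝ} (μ : Measure (GradConf p)) (x y : Site d) : ℝ :=
  ∫ u, (potential u x - potential u y) ∂μ

theorem meanDiff_edge {p : Site d → ℝ} (μ : Measure (GradConf p)) (e : Edge p) :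
    meanDiff μ e.1.1 e.1.2 = ∫ u, u.1 e ∂μ := by
  simp only [meanDiff, grad_potential]

theorem integrable_potential_sub (hi : ∀ e, Integrable (fun u : GradConf (nnKernel d) => u.1 e) μ)
    (x : Site d) {y : Site d} (hy : y ∈ neighbors d) :
    Integrable (fun u : GradConf (nnKernel d) => potential u x - potential u (x + y)) μ :=
  (hi (edgeTo x ⟨y, hy⟩)).congr
    (Eventually.of_forall fun u => (grad_potential u (edgeTo x ⟨y, hy⟩)).symm)

theorem meanDiff_sub_meanDiff (hi : ∀ e, Integrable (fun u : GradConf (nnKernel d) => u.1 e) μ)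
    (x : Site d) {a y : Site d} (ha : a ∈ neighbors d) (hy : y ∈ neighbors d) :
    meanDiff μ x (x + a) - meanDiff μ (x + y) (x + y + a) =
      meanDiff μ x (x + y) - meanDiff μ (x + a) (x + a + y) := by
  simp only [meanDiff]
  rw [← integral_sub (integrable_potential_sub hi _ ha) (integrable_potential_sub hi _ ha),
    ← integral_sub (integrable_potential_sub hi _ hy) (integrable_potential_sub hi _ hy)]
  congr 1
  funext u
  rw [add_right_comm x y a]
  ring

theorem IsGradientGibbs.neighborMean_meanDiff [NeZero d] [IsProbabilityMeasure μ]
    (h : IsGradientGibbs (nnKernel d) gaussianPotential η μ)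
    (hi : ∀ e, Integrable (fun u : GradConf (nnKernel d) => u.1 e) μ) (i : Site d) :
    neighborMean (meanDiff μ i) i = η i := by
  have hlaw : HasLaw (divergence i) (gaussianReal (η i) 1) μ :=
    ⟨(measurable_divergence i).aemeasurable, h.map_divergence i⟩
  calc neighborMean (meanDiff μ i) i
      = ∑ y : neighbors d, 1 / (2 * (d : ℝ)) * meanDiff μ i (i + y) :=
        (Finset.sum_coe_sort (neighbors d) _).symm
    _ = ∫ u, divergence i u ∂μ := by
        simp only [divergence]
        rw [integral_finsetSum _ fun y _ => (hi _).const_mul _]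
        refine Finset.sum_congr rfl fun y _ => ?_
        rw [integral_const_mul, ← meanDiff_edge]
        rfl
    _ = η i := by rw [hlaw.integral_eq, integral_id_gaussianReal]

theorem act_one_sub_lazyWalk [NeZero d] (v : Site d → ℝ) (x : Site d) :
    act (1 - lazyWalk d) v x = 1 / 2 * neighborMean (fun y => v x - v y) x := by
  have h : ∀ y, 1 / (4 * (d : ℝ)) * v (x + y) = 1 / 2 * (1 / (2 * (d : ℝ)) * v (x + y)) :=
    fun y => by ring
  rw [← sub_neighborMean]
  simp only [lazyWalk, map_sub, map_add, map_sum, map_one, LinearMap.sub_apply,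
    LinearMap.add_apply, LinearMap.sum_apply, Module.End.one_apply, Pi.sub_apply, Pi.add_apply,
    Finset.sum_apply, act_single, add_zero, h, neighborMean, ← Finset.mul_sum]
  ring

theorem IsGradientGibbs.act_one_sub_lazyWalk_meanDiff [NeZero d] [IsProbabilityMeasure μ]
    (h : IsGradientGibbs (nnKernel d) gaussianPotential η μ)
    (hi : ∀ e, Integrable (fun u : GradConf (nnKernel d) => u.1 e) μ) {a : Site d}
    (ha : a ∈ neighbors d) :
    act (1 - lazyWalk d) (fun x => meanDiff μ x (x + a)) =
      act ((1 / 2 : ℝ) • (1 - single a 1)) η := by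
  funext x
  have hη : act ((1 / 2 : ℝ) • (1 - single a 1)) η x = 1 / 2 * (η x - η (x + a)) := by
    simp only [map_sub, map_smul, map_one, LinearMap.smul_apply, LinearMap.sub_apply,
      Module.End.one_apply, Pi.smul_apply, Pi.sub_apply, act_single, smul_eq_mul, one_mul]
  rw [hη, act_one_sub_lazyWalk, ← h.neighborMean_meanDiff hi x,
    ← h.neighborMean_meanDiff hi (x + a)]
  simp only [neighborMean]
  rw [← Finset.sum_sub_distrib]
  congr 1
  refine Finset.sum_congr rfl fun y hy => ?_
  rw [meanDiff_sub_meanDiff hi x ha hy, mul_sub]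

theorem IsGradientGibbs.meanDiff_eq [NeZero d] [IsProbabilityMeasure μ]
    (h : IsGradientGibbs (nnKernel d) gaussianPotential η μ)
    (hi : ∀ e, Integrable (fun u : GradConf (nnKernel d) => u.1 e) μ) {a : Site d}
    (ha : a ∈ neighbors d) (n : ℕ) (x : Site d) :
    meanDiff μ x (x + a) = act (greenGradient a (Finset.range n)) η x +
      act (lazyWalk d ^ n) (fun x => meanDiff μ x (x + a)) x := by
  have hgreen : greenGradient a (Finset.range n) =
      (∑ k ∈ Finset.range n, lazyWalk d ^ k) * ((1 / 2 : ℝ) • (1 - single a 1)) := by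
    rw [greenGradient, mul_smul_comm, mul_comm]
  have hact : act (greenGradient a (Finset.range n)) η =
      act (1 - lazyWalk d ^ n) (fun x => meanDiff μ x (x + a)) := by
    rw [hgreen, map_mul, Module.End.mul_apply, ← h.act_one_sub_lazyWalk_meanDiff hi ha,
      ← Module.End.mul_apply, ← map_mul, geom_sum_mul_neg]
  rw [hact]
  simp [map_sub]

end MeanGradient

section LpConvergence

variable {Ω : Type*} [MeasurableSpace Ω] {P : Measure Ω}

theorem eLpNorm_sub_le_of_cauchy {p q : ℝ≥0∞} (hp : p ≠ 0) {G : ℕ → Ω → ℝ} {w : Ω → ℝ}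
    {δ : ℕ → ℝ≥0∞} (hG : ∀ n, AEStronglyMeasurable (G n) P) (hw : AEStronglyMeasurable w P)
    (hlim : Tendsto (fun n => eLpNorm (G n - w) p P) atTop (nhds 0))
    (hδ : ∀ m n, m ≤ n → eLpNorm (G n - G m) q P ≤ δ m) (m : ℕ) :
    eLpNorm (w - G m) q P ≤ δ m := by
  obtain ⟨ns, hns, hae⟩ :=
    (tendstoInMeasure_of_tendsto_eLpNorm hp hG hw hlim).exists_seq_tendsto_ae
  have hfatou := Lp.eLpNorm_lim_le_liminf_eLpNorm (p := q) (μ := P)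
    (f := fun k => G (ns k) - G m) (fun k => (hG (ns k)).sub (hG m)) (w - G m) (by
      filter_upwards [hae] with ω hω
      exact hω.sub_const _)
  refine hfatou.trans (liminf_le_of_frequently_le' (Eventually.frequently ?_))
  filter_upwards [eventually_ge_atTop m] with k hk
  exact hδ m (ns k) (hk.trans (hns.id_le k))

theorem memLp_and_tendsto_eLpNorm_of_cauchy {p q : ℝ≥0∞} (hp : p ≠ 0) {G : ℕ → Ω → ℝ}
    {w : Ω → ℝ} {δ : ℕ → ℝ≥0∞} (hG : ∀ n, MemLp (G n) q P) (hw : AEStronglyMeasurable w P)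
    (hlim : Tendsto (fun n => eLpNorm (G n - w) p P) atTop (nhds 0))
    (hδ : ∀ m n, m ≤ n → eLpNorm (G n - G m) q P ≤ δ m) (hδ0 : Tendsto δ atTop (nhds 0)) :
    MemLp w q P ∧ Tendsto (fun n => eLpNorm (G n - w) q P) atTop (nhds 0) := by
  have hle := eLpNorm_sub_le_of_cauchy hp (fun n => (hG n).1) hw hlim hδ
  constructor
  · obtain ⟨m, hm⟩ := (hδ0.eventually_lt_const ENNReal.zero_lt_top).exists
    have hsub : MemLp (w - G m) q P := ⟨hw.sub (hG m).1, (hle m).trans_lt hm⟩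
    simpa using hsub.add (hG m)
  · refine tendsto_of_tendsto_of_tendsto_of_le_of_le tendsto_const_nhds hδ0
      (fun _ => zero_le) fun n => ?_
    simpa only [eLpNorm_sub_comm (G n) w] using hle n

theorem tendsto_integral_mul_of_tendsto_eLpNorm {X Y : ℕ → Ω → ℝ} {X' Y' : Ω → ℝ}
    (hX : ∀ n, MemLp (X n) 2 P) (hY : ∀ n, MemLp (Y n) 2 P) (hX' : MemLp X' 2 P)
    (hY' : MemLp Y' 2 P) (h1 : Tendsto (fun n => eLpNorm (X n - X') 2 P) atTop (nhds 0))
    (h2 : Tendsto (fun n => eLpNorm (Y n - Y') 2 P) atTop (nhds 0)) :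
    Tendsto (fun n => ∫ ω, X n ω * Y n ω ∂P) atTop (nhds (∫ ω, X' ω * Y' ω ∂P)) := by
  have hinner : ∀ {f g : Ω → ℝ} (hf : MemLp f 2 P) (hg : MemLp g 2 P),
      inner ℝ (hf.toLp f) (hg.toLp g) = ∫ ω, f ω * g ω ∂P := fun {f g} hf hg => by
    rw [L2.inner_def]
    refine integral_congr_ae ?_
    filter_upwards [hf.coeFn_toLp, hg.coeFn_toLp] with ω hfω hgω
    rw [hfω, hgω]
    simp [mul_comm]
  have t1 := (Lp.tendsto_Lp_iff_tendsto_eLpNorm'' X hX X' hX').2 h1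
  have t2 := (Lp.tendsto_Lp_iff_tendsto_eLpNorm'' Y hY Y' hY').2 h2
  simpa only [hinner] using t1.inner (𝕜 := ℝ) t2

end LpConvergence

section GreenField

open AddMonoidAlgebra

variable {d : ℕ} {ν : Measure ℝ} [IsProbabilityMeasure ν]

theorem integral_act_mul_act (hν : MemLp (fun x : ℝ => x) 2 ν) {f : ℝ[Site d]} (hf : mass f = 0)
    (g : ℝ[Site d]) (x y : Site d) :
    ∫ η, act f η x * act g η y ∂(disorderLaw d ν) =
      Var[fun t : ℝ => t; ν] * (f * reflect g).coeff (y - x) := by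
  rw [← covariance_act hν, covariance_eq_sub (memLp_act hν _ _) (memLp_act hν _ _),
    integral_act hν f, hf, zero_mul, zero_mul, sub_zero]
  rfl

/-- The gradient at `x` in the direction `a` of the height field that the disorder creates up to
the time `n` of the lazy walk. -/
def greenField (a : Site d) (n : ℕ) (x : Site d) (η : Site d → ℝ) : ℝ :=
  act (greenGradient a (Finset.range n)) η x

theorem memLp_greenField (hν : MemLp (fun x : ℝ => x) 2 ν) (a : Site d) (n : ℕ) (x : Site d) :
    MemLp (greenField a n x) 2 (disorderLaw d ν) := memLp_act hν _ _

theorem exists_greenField_cauchy (hd : 3 ≤ d) (hν : MemLp (fun x : ℝ => x) 2 ν) (a : Site d) :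
    ∃ δ : ℕ → ℝ≥0∞, Tendsto δ atTop (nhds 0) ∧ ∀ (x : Site d) (m n : ℕ), m ≤ n →
      eLpNorm (greenField a n x - greenField a m x) 2 (disorderLaw d ν) ≤ δ m := by
  obtain ⟨K, hK⟩ := exists_greenGradient_variance_le hd a
  refine ⟨fun m => ENNReal.ofReal (√(Var[fun t : ℝ => t; ν] * (K / √((m : ℝ) + 1) ^ (d - 2)))),
    ?_, fun x m n hmn => ?_⟩
  · have hatTop : Tendsto (fun m : ℕ => √((m : ℝ) + 1) ^ (d - 2)) atTop atTop :=
      (tendsto_pow_atTop (by lia)).comp (Real.tendsto_sqrt_atTop.comp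
        (tendsto_atTop_add_const_right _ _ tendsto_natCast_atTop_atTop))
    have hzero := ((tendsto_const_nhds (x := K)).div_atTop hatTop).const_mul
      (Var[fun t : ℝ => t; ν])
    simpa using ENNReal.tendsto_ofReal hzero.sqrt
  · have hsub : greenField a n x - greenField a m x =
        fun η => act (greenGradient a (Finset.Ico m n)) η x := by
      funext η
      rw [← greenGradient_range_sub a hmn, map_sub]
      rfl
    rw [hsub, eLpNorm_two_eq_sqrt (memLp_act hν _ _)]
    simp only [sq]
    rw [integral_act_mul_act hν (mass_greenGradient a _), sub_self]
    gcongr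
    · exact variance_nonneg _ _
    · exact (le_abs_self _).trans (hK m n)

theorem memLp_and_tendsto_greenField (hd : 3 ≤ d) (hν : MemLp (fun x : ℝ => x) 2 ν) {a x : Site d}
    {w : (Site d → ℝ) → ℝ} (hw : AEStronglyMeasurable w (disorderLaw d ν))
    (hlim : Tendsto (fun n => eLpNorm (greenField a n x - w) 1 (disorderLaw d ν)) atTop (nhds 0)) :
    MemLp w 2 (disorderLaw d ν) ∧
      Tendsto (fun n => eLpNorm (greenField a n x - w) 2 (disorderLaw d ν)) atTop (nhds 0) := by
  obtain ⟨δ, hδ0, hδ⟩ := exists_greenField_cauchy hd hν a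
  exact memLp_and_tendsto_eLpNorm_of_cauchy one_ne_zero (memLp_greenField hν a · x) hw hlim (hδ x)
    hδ0

theorem exists_integral_greenField_mul_le (hd : 3 ≤ d) (hν : MemLp (fun x : ℝ => x) 2 ν) :
    ∃ M : ℝ, ∀ a ∈ neighbors d, ∀ b ∈ neighbors d, ∀ (n : ℕ) (x y : Site d),
      |∫ η, greenField a n x η * greenField b n y η ∂(disorderLaw d ν)| *
        siteDist x y ^ (d - 2) ≤ M := by
  choose K hK using exists_greenGradient_covariance_le hd
  obtain ⟨B, hB⟩ := Finite.bddAbove_range fun ab : neighbors d × neighbors d => K ab.1 ab.2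
  refine ⟨Var[fun t : ℝ => t; ν] * B, fun a ha b hb n x y => ?_⟩
  have hσ : 0 ≤ Var[fun t : ℝ => t; ν] := variance_nonneg _ _
  simp only [greenField]
  rw [integral_act_mul_act hν (mass_greenGradient a _), abs_mul, abs_of_nonneg hσ, mul_assoc]
  exact mul_le_mul_of_nonneg_left ((hK a b n x y).trans
    (hB ⟨(⟨a, ha⟩, ⟨b, hb⟩), rfl⟩)) hσ

end GreenField

section VectorField

variable {d : ℕ} {ν : Measure ℝ} [IsProbabilityMeasure ν]
  {μ : Kernel (Site d → ℝ) (GradConf (nnKernel d))}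

theorem deriv_gaussianPotential (t : ℝ) : deriv gaussianPotential t = t := by
  have h : HasDerivAt gaussianPotential (((2 : ℕ) : ℝ) * t ^ (2 - 1) / 2) t :=
    (hasDerivAt_pow 2 t).div_const 2
  rw [h.deriv]
  simp

/-- The direction of an edge. -/
def direction {p : Site d → ℝ} (e : Edge p) : Site d := e.1.2 - e.1.1

theorem direction_mem_neighbors (e : Edge (nnKernel d)) : direction e ∈ neighbors d := by
  rw [← neg_mem_neighbors, direction, neg_sub]
  exact nnKernel_pos_iff.1 e.2

theorem add_direction {p : Site d → ℝ} (e : Edge p) : e.1.1 + direction e = e.1.2 :=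
  add_sub_cancel _ _

theorem measurable_shiftGrad {p : Site d → ℝ} (r : Site d) :
    Measurable (shiftGrad r : GradConf p → GradConf p) :=
  Measurable.subtype_mk (f := fun (u : GradConf p) (e : Edge p) =>
      u.1 ⟨(e.1.1 - r, e.1.2 - r), by simpa using e.2⟩)
    (measurable_pi_lambda _ fun _ => measurable_gradConf_apply _)

theorem vectorField_eq_meanDiff {p : Site d → ℝ} (μ : Kernel (Site d → ℝ) (GradConf p))
    (e : Edge p) (η : Site d → ℝ) :
    vectorField gaussianPotential μ e η = meanDiff (μ η) e.1.1 e.1.2 := by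
  simp only [vectorField, deriv_gaussianPotential, meanDiff_edge]

theorem meanDiff_map_shiftGrad {p : Site d → ℝ} (μ : Measure (GradConf p)) (r : Site d)
    (e : Edge p) :
    meanDiff (μ.map (shiftGrad r)) e.1.1 e.1.2 = meanDiff μ (e.1.1 - r) (e.1.2 - r) := by
  rw [meanDiff_edge, integral_map (measurable_shiftGrad r).aemeasurable
    (measurable_gradConf_apply e).aestronglyMeasurable]
  exact (meanDiff_edge μ ⟨(e.1.1 - r, e.1.2 - r), by simpa using e.2⟩).symm

theorem IsRandomGradientGibbs.vectorField_ae_eq [NeZero d]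
    (hμ : IsRandomGradientGibbs (nnKernel d) gaussianPotential (disorderLaw d ν) μ)
    (hint : ∀ e : Edge (nnKernel d), ∀ᵐ η ∂(disorderLaw d ν),
      Integrable (fun u : GradConf (nnKernel d) => deriv gaussianPotential (u.1 e)) (μ η))
    (e : Edge (nnKernel d)) (n : ℕ) :
    vectorField gaussianPotential μ e =ᵐ[disorderLaw d ν]
      greenField (direction e) n e.1.1 +
        orbitAverage (lazyWalk d ^ n) (vectorField gaussianPotential μ e) := by
  have := hμ.markov
  filter_upwards [hμ.gibbs, ae_all_iff.2 hint, ae_all_iff.2 fun y => hμ.covariant (-y)]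
    with η hgibbs hi hcov
  simp only [deriv_gaussianPotential] at hi
  have hshift : ∀ y, vectorField gaussianPotential μ e (shift (-y) η) =
      meanDiff (μ η) (e.1.1 + y) (e.1.1 + y + direction e) := fun y => by
    rw [vectorField_eq_meanDiff, hcov, meanDiff_map_shiftGrad, sub_neg_eq_add, sub_neg_eq_add,
      add_right_comm, add_direction]
  have hmean := hgibbs.meanDiff_eq hi (direction_mem_neighbors e) n e.1.1
  rw [add_direction, ← vectorField_eq_meanDiff, act_eq_pairing (lazyWalk d ^ n)] at hmean
  simp only [← hshift] at hmean
  exact hmean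

theorem IsRandomGradientGibbs.tendsto_greenField [NeZero d]
    (hμ : IsRandomGradientGibbs (nnKernel d) gaussianPotential (disorderLaw d ν) μ)
    (hint : ∀ e : Edge (nnKernel d), ∀ᵐ η ∂(disorderLaw d ν),
      Integrable (fun u : GradConf (nnKernel d) => deriv gaussianPotential (u.1 e)) (μ η))
    {e : Edge (nnKernel d)}
    (hX : Integrable (vectorField gaussianPotential μ e) (disorderLaw d ν)) :
    Tendsto (fun n => eLpNorm (greenField (direction e) n e.1.1 -
      (vectorField gaussianPotential μ e -
        fun _ => ∫ η, vectorField gaussianPotential μ e η ∂(disorderLaw d ν))) 1 (disorderLaw d ν))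
      atTop (nhds 0) := by
  refine (ergodicAlongWalk_of_integrable hX).congr fun n => ?_
  rw [ergodicError, ← eLpNorm_neg]
  refine eLpNorm_congr_ae ?_
  filter_upwards [hμ.vectorField_ae_eq hint e n] with η hη
  simp only [Pi.add_apply] at hη
  simp only [Pi.neg_apply, Pi.sub_apply]
  linarith

theorem IsRandomGradientGibbs.memLp_and_tendsto_greenField (hd : 3 ≤ d)
    (hν : MemLp (fun x : ℝ => x) 2 ν)
    (hμ : IsRandomGradientGibbs (nnKernel d) gaussianPotential (disorderLaw d ν) μ)
    (hint : ∀ e : Edge (nnKernel d), ∀ᵐ η ∂(disorderLaw d ν),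
      Integrable (fun u : GradConf (nnKernel d) => deriv gaussianPotential (u.1 e)) (μ η))
    {e : Edge (nnKernel d)}
    (hX : Integrable (vectorField gaussianPotential μ e) (disorderLaw d ν)) :
    MemLp (vectorField gaussianPotential μ e) 2 (disorderLaw d ν) ∧
      Tendsto (fun n => eLpNorm (greenField (direction e) n e.1.1 -
        (vectorField gaussianPotential μ e -
          fun _ => ∫ η, vectorField gaussianPotential μ e η ∂(disorderLaw d ν))) 2
            (disorderLaw d ν)) atTop (nhds 0) := by
  have : NeZero d := ⟨by lia⟩
  obtain ⟨hmem, hlim⟩ := RandomInterface.memLp_and_tendsto_greenField hd hν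
    (hX.sub (integrable_const _)).1 (hμ.tendsto_greenField hint hX)
  refine ⟨?_, hlim⟩
  simpa only [sub_add_cancel] using hmem.add (memLp_const
    (∫ η, vectorField gaussianPotential μ e η ∂(disorderLaw d ν)))

theorem IsRandomGradientGibbs.exists_covariance_le (hd : 3 ≤ d)
    (hν : MemLp (fun x : ℝ => x) 2 ν)
    (hμ : IsRandomGradientGibbs (nnKernel d) gaussianPotential (disorderLaw d ν) μ)
    (hint : ∀ e : Edge (nnKernel d), ∀ᵐ η ∂(disorderLaw d ν),
      Integrable (fun u : GradConf (nnKernel d) => deriv gaussianPotential (u.1 e)) (μ η))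
    (hX : ∀ e : Edge (nnKernel d),
      Integrable (vectorField gaussianPotential μ e) (disorderLaw d ν)) :
    ∃ M : ℝ, ∀ e f : Edge (nnKernel d),
      |cov[vectorField gaussianPotential μ e, vectorField gaussianPotential μ f;
        disorderLaw d ν]| * siteDist e.1.1 f.1.1 ^ (d - 2) ≤ M := by
  obtain ⟨M, hM⟩ := exists_integral_greenField_mul_le hd hν
  refine ⟨M, fun e f => ?_⟩
  obtain ⟨hmemE, hlimE⟩ := hμ.memLp_and_tendsto_greenField hd hν hint (hX e)
  obtain ⟨hmemF, hlimF⟩ := hμ.memLp_and_tendsto_greenField hd hν hint (hX f)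
  have hlim := tendsto_integral_mul_of_tendsto_eLpNorm (memLp_greenField hν (direction e) · e.1.1)
    (memLp_greenField hν (direction f) · f.1.1) (hmemE.sub (memLp_const _))
    (hmemF.sub (memLp_const _)) hlimE hlimF
  exact le_of_tendsto (hlim.abs.mul_const _) (Eventually.of_forall fun n =>
    hM _ (direction_mem_neighbors e) _ (direction_mem_neighbors f) n _ _)

end VectorField

theorem limsup_decaySup_lt_top {d : ℕ} {p : Site d → ℝ} {D : Edge p → Edge p → ℝ} {M : ℝ}
    (h : ∀ e f : Edge p, |D e f| * siteDist e.1.1 f.1.1 ≤ M) :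
    limsup (decaySup D) atTop < ⊤ := by
  refine lt_of_le_of_lt (limsup_le_of_le (a := ENNReal.ofReal M) ?_ ?_) ENNReal.ofReal_lt_top
  · isBoundedDefault
  · refine Eventually.of_forall fun r => iSup_le fun e => iSup_le fun f => iSup_le fun hef =>
      ENNReal.ofReal_le_ofReal ?_
    rw [div_inv_eq_mul]
    exact (mul_le_mul_of_nonneg_left hef (abs_nonneg _)).trans (h e f)

end

end RandomInterface

theorem proposition2p4_general {d : ℕ} (hd : 3 ≤ d)
    (ν : Measure ℝ) [IsProbabilityMeasure ν] (hν : MemLp (fun x : ℝ => x) 2 ν)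
    (μ : Kernel (Site d → ℝ) (GradConf (nnKernel d)))
    (hμ : IsRandomGradientGibbs (nnKernel d) gaussianPotential (disorderLaw d ν) μ)
    (hint : ∀ e : Edge (nnKernel d), ∀ᵐ η ∂(disorderLaw d ν),
      Integrable (fun u : GradConf (nnKernel d) => deriv gaussianPotential (u.1 e)) (μ η))
    (hX : ∀ e : Edge (nnKernel d),
      Integrable (vectorField gaussianPotential μ e) (disorderLaw d ν)) :
    (∀ e : Edge (nnKernel d), MemLp (vectorField gaussianPotential μ e) 2 (disorderLaw d ν)) ∧
    (∃ M : ℝ, ∀ e f : Edge (nnKernel d),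
      |cov[vectorField gaussianPotential μ e, vectorField gaussianPotential μ f;
        disorderLaw d ν]| * siteDist e.1.1 f.1.1 ^ (d - 2) ≤ M) ∧
    ((∀ e : Edge (nnKernel d), ∫ η, vectorField gaussianPotential μ e η ∂(disorderLaw d ν) = 0) →
      ∃ M : ℝ, ∀ e f : Edge (nnKernel d),
        |∫ η, vectorField gaussianPotential μ e η * vectorField gaussianPotential μ f η
          ∂(disorderLaw d ν)| * siteDist e.1.1 f.1.1 ^ (d - 2) ≤ M) := by
  have hcov := hμ.exists_covariance_le hd hν hint hX
  refine ⟨fun e => (hμ.memLp_and_tendsto_greenField hd hν hint (hX e)).1, hcov, fun h0 => ?_⟩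
  simpa only [covariance, h0, sub_zero] using hcov

theorem proposition2p4
    (ν : Measure ℝ) [IsProbabilityMeasure ν] (hν : MemLp (fun x : ℝ => x) 2 ν)
    (μ : Kernel (Site 3 → ℝ) (GradConf (nnKernel 3)))
    (hμ : IsRandomGradientGibbs (nnKernel 3) gaussianPotential (disorderLaw 3 ν) μ)
    (hint : ∀ e : Edge (nnKernel 3), ∀ᵐ η ∂(disorderLaw 3 ν),
      Integrable (fun u : GradConf (nnKernel 3) => deriv gaussianPotential (u.1 e)) (μ η))
    (hX : ∀ e : Edge (nnKernel 3),
      Integrable (vectorField gaussianPotential μ e) (disorderLaw 3 ν)) :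
    -- the associated vector field has finite second moments
    (∀ e : Edge (nnKernel 3), MemLp (vectorField gaussianPotential μ e) 2 (disorderLaw 3 ν)) ∧
    -- decay of its covariance with respect to the disorder
    limsup (decaySup fun e f : Edge (nnKernel 3) =>
      cov[vectorField gaussianPotential μ e, vectorField gaussianPotential μ f;
        disorderLaw 3 ν]) atTop < ⊤ ∧
    -- decay of `C(ij, kl) = 𝔼 (X_{ij} X_{kl})` for a measure without tilt
    ((∀ e : Edge (nnKernel 3), ∫ η, vectorField gaussianPotential μ e η ∂(disorderLaw 3 ν) = 0) →
      limsup (decaySup fun e f : Edge (nnKernel 3) =>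
        ∫ η, vectorField gaussianPotential μ e η * vectorField gaussianPotential μ f η
          ∂(disorderLaw 3 ν)) atTop < ⊤) := by
  obtain ⟨hL2, hcov, hnotilt⟩ := proposition2p4_general le_rfl ν hν μ hμ hint hX
  simp only [Nat.reduceSub, pow_one] at hcov hnotilt
  exact ⟨hL2, hcov.elim fun _ => limsup_decaySup_lt_top,
    fun h0 => (hnotilt h0).elim fun _ => limsup_decaySup_lt_top⟩
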